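/- Let $k$ be a fixed positive integer. All graphs are finite and simple. A matching of a graph $G$ is a set of edges of $G$ no two of which share an endpoint; it is an induced matching if, moreover, no edge of $G$ joins endpoints of two different edges of the matching. Call $G$ $k$-well-indumatched if all of its inclusion-wise maximal induced matchings have size exactly $k$. Weighted Independent Set is polynomial-time solvable when restricted to $k$-well-indumatched graphs. That is, there are a (multi-stack) Turing machine and a polynomial $p$, both depending only on $k$, with the following property. For every $n$, every $k$-well-indumatched graph $G$ with vertex set $\{0,\dots,n-1\}$ and all vertex weights $w(0),\dots,w(n-1)\in\mathbb{Z}_{\ge 0}$, given as input the string of length $L$ that lists the rows of the adjacency matrix of $G$, each followed by the weight of its vertex in binary, the machine halts within $p(L)$ steps and outputs the characteristic vector of an independent set $S$ of $G$ whose total weight $\sum_{v\in S}w(v)$ is maximum among all independent sets of $G$. -/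

import Mathlib

open Computability

/-- A matching of `G`: a set of edges, no two of which have a common endpoint. -/
def SimpleGraph.IsEdgeMatching {V : Type*} (G : SimpleGraph V) (M : Finset (Sym2 V)) : Prop :=
  (M : Set (Sym2 V)) ⊆ G.edgeSet ∧
    ∀ e ∈ M, ∀ f ∈ M, e ≠ f → ∀ u ∈ e, ∀ v ∈ f, u ≠ v

/-- An induced matching of `G`: a matching such that no edge of `G` joins two of its edges. -/
def SimpleGraph.IsInducedMatching {V : Type*} (G : SimpleGraph V) (M : Finset (Sym2 V)) : Prop :=
  G.IsEdgeMatching M ∧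
    ∀ e ∈ M, ∀ f ∈ M, e ≠ f → ∀ u ∈ e, ∀ v ∈ f, ¬ G.Adj u v

/-- `G` is `k`-well-indumatched: all inclusion-wise maximal induced matchings have size `k`. -/
def SimpleGraph.IsWellIndumatched {V : Type*} [Finite V] (G : SimpleGraph V) (k : ℕ) : Prop :=
  ∀ M : Finset (Sym2 V), Maximal G.IsInducedMatching M → M.card = k

/-- An input of Weighted Independent Set: a finite simple graph on the vertices `0, …, n - 1`,
with natural numbers as vertex weights. -/
structure VertexWeightedGraph where
  n : ℕ
  graph : SimpleGraph (Fin n)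
  weight : Fin n → ℕ

namespace VertexWeightedGraph

/-- `S` is an independent set of maximum total weight. -/
def IsMaxWeightIndepSet (I : VertexWeightedGraph) (S : Finset (Fin I.n)) : Prop :=
  I.graph.IsIndepSet (S : Set (Fin I.n)) ∧
    ∀ T : Finset (Fin I.n), I.graph.IsIndepSet (T : Set (Fin I.n)) →
      ∑ v ∈ T, I.weight v ≤ ∑ v ∈ S, I.weight v

open Classical in
/-- The input string: for each vertex in turn, its row of the adjacency matrix followed by its
weight in binary (least significant bit first). -/
noncomputable def encode (I : VertexWeightedGraph) : List Γ' :=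
  (List.finRange I.n).flatMap fun i =>
    [Γ'.bra] ++ (List.finRange I.n).map (fun j => Γ'.bit (decide (I.graph.Adj i j))) ++
    [Γ'.comma] ++ (encodeNat (I.weight i)).map Γ'.bit ++ [Γ'.ket]

/-- The characteristic vector of a set of vertices, as a string of `n` bits. -/
def charVec (I : VertexWeightedGraph) (S : Finset (Fin I.n)) : List Bool :=
  (List.finRange I.n).map fun i => decide (i ∈ S)

end VertexWeightedGraph

/-- The search problem `R`, on the inputs `α` encoded by `ea`, with answers in `β` encoded by `eb`,
is solvable in polynomial time: some Turing machine outputs, on every input `a`, an answer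
`b` with `R a b`, within a number of steps polynomial in the length of the encoded input. -/
def SolvableInPolyTime {α β αΓ βΓ : Type} (ea : α → List αΓ) (eb : β → List βΓ)
    (R : α → β → Prop) : Prop :=
  ∃ f : α → β, (∀ a, R a (f a)) ∧ Nonempty (Turing.TM2ComputableInPolyTime ea eb f)

/-- Weighted Independent Set, restricted to the graphs with the property `P`, is solvable in
polynomial time: given a weighted graph whose graph satisfies `P`, compute (the characteristic
vector of) an independent set of maximum weight. -/
def WeightedIndepSetSolvableInPolyTime (P : ∀ n : ℕ, SimpleGraph (Fin n) → Prop) : Prop :=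
  SolvableInPolyTime (α := {I : VertexWeightedGraph // P I.n I.graph}) (β := List Bool)
    (fun I => I.1.encode) (fun s => s)
    (fun I s => ∃ S : Finset (Fin I.1.n), I.1.IsMaxWeightIndepSet S ∧ s = I.1.charVec S)

/-! In a `k`-well-indumatched graph every induced matching extends to a maximal one, which has size
`k`, so there is no induced matching of size `k + 1`. For fixed `j`, a graph without an induced
matching of size `j` has only polynomially many maximal independent sets, and these can be listed.
The heaviest listed set is optimal, because weights are nonnegative and every independent set lies
in a maximal one.

The list is built by adding one vertex `v` at a time to a set `T` of earlier vertices. Let `S` be a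
maximal independent set of `v :: T`. If `S \ {v}` is maximal in `T`, then `S` arises from a listed
set of `T` by adding `v` when possible. Otherwise `v ∈ S`, and some `u ∈ T` outside `S` has no
neighbour in `S \ {v}`; by maximality of `S`, `u` is adjacent to `v`. Then `S \ {v}` is a maximal
independent set among the common non-neighbours of `u` and `v`, where there is no induced matching
of size `j - 1`, since the edge `uv` would enlarge it. So recursion on `j` suffices
(`exists_mem_misList`). Each vertex adds at most `n` recursive families, which gives a polynomial of
degree `2 * (j - 1)` for `j ≥ 1` (`length_misList_le`).

The rest is the running time on an actual machine. Structured stack programs with a timed big-step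
semantics compile to Turing machines (`Exec.simulate`). The class `PT` of functions computed by such
programs on tree-coded data is closed under composition, pairing, case distinction and folds whose
intermediate results stay polynomially small (`PT.foldl`). The algorithm is an ordinary function
`solve`, and `PT.solve` follows from these closure properties; `exists_isMaxWeightIndepSet` is its
correctness. -/

/-! ### Structured programs on stacks and their compilation to Turing machines -/

/-- Structured programs acting on stacks indexed by `K`, with alphabets `Γ`. Both `case` and `loop`
pop a symbol from a stack and act on the result; `loop` iterates as long as the test succeeds. -/
inductive StackProg {K : Type} (Γ : K → Type) : Type
  | skip : StackProg Γ
  | push (k : K) (a : Γ k) : StackProg Γ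
  | seq (p q : StackProg Γ) : StackProg Γ
  | case (k : K) (f : Option (Γ k) → StackProg Γ) : StackProg Γ
  | loop (k : K) (c : Option (Γ k) → Bool) (f : Option (Γ k) → StackProg Γ) : StackProg Γ

namespace StackProg

variable {K : Type} {Γ : K → Type}

/-- `Exec p S t S'`: the program `p` transforms the stacks `S` into `S'` within time `t`. -/
inductive Exec [DecidableEq K] :
    StackProg Γ → (∀ k, List (Γ k)) → ℕ → (∀ k, List (Γ k)) → Prop
  | skip (S) : Exec skip S 1 S
  | push (k a S) : Exec (push k a) S 1 (Function.update S k (a :: S k))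
  | seq {p q S t S' t' S''} : Exec p S t S' → Exec q S' t' S'' → Exec (seq p q) S (t + t') S''
  | case {k f S t S'} :
      Exec (f (S k).head?) (Function.update S k (S k).tail) t S' → Exec (case k f) S (t + 1) S'
  | loop_done {k c f S} : c (S k).head? = false →
      Exec (loop k c f) S 1 (Function.update S k (S k).tail)
  | loop_step {k c f S t S' t' S''} : c (S k).head? = true →
      Exec (f (S k).head?) (Function.update S k (S k).tail) t S' → Exec (loop k c f) S' t' S'' →
      Exec (loop k c f) S (t + t' + 1) S''
  | weaken {p S t t' S'} : Exec p S t S' → t ≤ t' → Exec p S t' S'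

/-- The labels of the machine code of a program. -/
def Label : StackProg Γ → Type
  | skip => Unit
  | push _ _ => Unit
  | seq p q => Label p ⊕ Label q
  | case _ f => Unit ⊕ Σ x, Label (f x)
  | loop _ _ f => Unit ⊕ Σ x, Label (f x)

/-- The set of labels of a program is finite. -/
@[reducible]
noncomputable def labelFintype [∀ k, Fintype (Γ k)] : ∀ p : StackProg Γ, Fintype (Label p)
  | skip => inferInstanceAs (Fintype Unit)
  | push _ _ => inferInstanceAs (Fintype Unit)
  | seq p q =>
    letI := labelFintype p
    letI := labelFintype q
    inferInstanceAs (Fintype (Label p ⊕ Label q))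
  | case k f =>
    letI := fun x => labelFintype (f x)
    inferInstanceAs (Fintype (Unit ⊕ Σ x : Option (Γ k), Label (f x)))
  | loop k _ f =>
    letI := fun x => labelFintype (f x)
    inferInstanceAs (Fintype (Unit ⊕ Σ x : Option (Γ k), Label (f x)))

/-- The label at which the execution of a program starts. -/
def entry : ∀ p : StackProg Γ, Label p
  | skip => ()
  | push _ _ => ()
  | seq p _ => Sum.inl (entry p)
  | case _ _ => Sum.inl ()
  | loop _ _ _ => Sum.inl ()

variable [DecidableEq K]

/-- The machine code of a program, for a given embedding of its labels and a given exit label.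
The internal state of the machine is the symbol popped last from each stack. -/
def code {L : Type} : ∀ p : StackProg Γ, (Label p → L) → L → Label p →
    Turing.TM2.Stmt Γ L (∀ k, Option (Γ k))
  | skip, _, e, _ => .goto fun _ => e
  | push k a, _, e, _ => .push k (fun _ => a) (.goto fun _ => e)
  | seq p q, ι, _, .inl l => code p (fun x => ι (.inl x)) (ι (.inr (entry q))) l
  | seq _ q, ι, e, .inr l => code q (fun x => ι (.inr x)) e l
  | case k f, ι, _, .inl _ =>
    .pop k (fun v x => Function.update v k x) (.goto fun v => ι (.inr ⟨v k, entry (f (v k))⟩))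
  | case _ f, ι, e, .inr ⟨x, l⟩ => code (f x) (fun y => ι (.inr ⟨x, y⟩)) e l
  | loop k c f, ι, e, .inl _ =>
    .pop k (fun v x => Function.update v k x)
      (.goto fun v => if c (v k) then ι (.inr ⟨v k, entry (f (v k))⟩) else e)
  | loop _ _ f, ι, _, .inr ⟨x, l⟩ => code (f x) (fun y => ι (.inr ⟨x, y⟩)) (ι (.inl ())) l

/-- A machine containing the code of `p` simulates the execution of `p`. -/
theorem Exec.simulate {p : StackProg Γ} {S S' : ∀ k, List (Γ k)} {t : ℕ} (h : Exec p S t S') :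
    ∀ {L : Type} (M : L → Turing.TM2.Stmt Γ L (∀ k, Option (Γ k))) (ι : Label p → L) (e : L),
      (∀ l, M (ι l) = code p ι e l) → ∀ v, ∃ n ≤ t, ∃ v',
        (flip bind (Turing.TM2.step M))^[n] (some ⟨some (ι (entry p)), v, S⟩) =
          some ⟨some e, v', S'⟩ := by
  induction h with
  | skip S =>
    intro L M ι e hM v
    refine ⟨1, le_rfl, v, ?_⟩
    have := hM ()
    simp [flip, entry, Turing.TM2.step, this, code]
  | push k a S =>
    intro L M ι e hM v
    refine ⟨1, le_rfl, v, ?_⟩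
    have := hM ()
    simp [flip, entry, Turing.TM2.step, this, code]
  | @seq p q S t S' t' S'' _ _ ih₁ ih₂ =>
    intro L M ι e hM v
    obtain ⟨n₁, hn₁, v₁, h₁⟩ := ih₁ M (fun x => ι (.inl x)) (ι (.inr (entry q)))
      (fun l => (hM (.inl l)).trans (by simp [code])) v
    obtain ⟨n₂, hn₂, v₂, h₂⟩ := ih₂ M (fun x => ι (.inr x)) e
      (fun l => (hM (.inr l)).trans (by simp [code])) v₁
    refine ⟨n₂ + n₁, by omega, v₂, ?_⟩
    rw [Function.iterate_add_apply]
    exact (congrArg _ h₁).trans h₂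
  | @case k f S t S' _ ih =>
    intro L M ι e hM v
    obtain ⟨n, hn, v', h⟩ := ih M (fun x => ι (.inr ⟨_, x⟩)) e
      (fun l => (hM (.inr ⟨_, l⟩)).trans (by simp [code])) (Function.update v k (S k).head?)
    refine ⟨n + 1, by omega, v', ?_⟩
    rw [Function.iterate_add_apply, ← h]
    have := hM (.inl ())
    congr 1
    simp only [flip, entry, Turing.TM2.step, this, code, Function.iterate_one, Option.bind_eq_bind,
      Option.bind_some, Turing.TM2.stepAux]
    -- The type of the entry label depends on the popped symbol, so the symbol is replaced in the
    -- whole label at once.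
    rw [congrArg (fun x => ι (.inr ⟨x, entry (f x)⟩)) (Function.update_self k (S k).head? v)]
  | @loop_done k c f S hc =>
    intro L M ι e hM v
    refine ⟨1, le_rfl, Function.update v k (S k).head?, ?_⟩
    have := hM (.inl ())
    simp [flip, entry, Turing.TM2.step, this, code, hc]
  | @loop_step k c f S t S' t' S'' hc _ _ ih₁ ih₂ =>
    intro L M ι e hM v
    obtain ⟨n₁, hn₁, v₁, h₁⟩ := ih₁ M (fun x => ι (.inr ⟨_, x⟩)) (ι (.inl ()))
      (fun l => (hM (.inr ⟨_, l⟩)).trans (by simp [code])) (Function.update v k (S k).head?)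
    obtain ⟨n₂, hn₂, v₂, h₂⟩ := ih₂ M ι e hM v₁
    refine ⟨n₂ + (n₁ + 1), by omega, v₂, ?_⟩
    rw [Function.iterate_add_apply, ← h₂]
    refine congrArg _ (Eq.trans ?_ h₁)
    rw [Function.iterate_add_apply]
    have := hM (.inl ())
    congr 1
    simp only [flip, entry, Turing.TM2.step, this, code, Function.iterate_one, Option.bind_eq_bind,
      Option.bind_some, Turing.TM2.stepAux]
    rw [congrArg (fun x => if c x then ι (.inr ⟨x, entry (f x)⟩) else e)
      (Function.update_self k (S k).head? v), if_pos hc]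
  | weaken _ hle ih =>
    intro L M ι e hM v
    obtain ⟨n, hn, h⟩ := ih M ι e hM v
    exact ⟨n, hn.trans hle, h⟩

/-- The Turing machine executing a program. -/
noncomputable def machine [Fintype K] [∀ k, Fintype (Γ k)] (p : StackProg Γ) (k₀ k₁ : K) :
    Turing.FinTM2 :=
  letI := labelFintype p
  { K := K
    k₀ := k₀
    k₁ := k₁
    Γ := Γ
    Λ := Option (Label p)
    main := some (entry p)
    σ := ∀ k, Option (Γ k)
    initialState := fun _ => none
    -- The exit label resets the internal state, because a halting configuration must carry the
    -- initial one. This is the extra step in `Exec.outputsInTime`.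
    m := fun l => l.elim (.load (fun _ _ => none) .halt) (code p some none) }

/-- The stacks that are empty except for the stack `k`. -/
def single (k : K) (s : List (Γ k)) : ∀ k, List (Γ k) := Function.update (fun _ => []) k s

theorem single_self (k : K) (s : List (Γ k)) : single k s k = s := Function.update_self ..

theorem single_of_ne {k k' : K} (h : k' ≠ k) (s : List (Γ k)) : single k s k' = [] :=
  Function.update_of_ne h ..

theorem Exec.outputsInTime [Fintype K] [∀ k, Fintype (Γ k)] {p : StackProg Γ} {k₀ k₁ : K}
    {s : List (Γ k₀)} {s' : List (Γ k₁)} {t : ℕ} (h : Exec p (single k₀ s) t (single k₁ s')) :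
    Nonempty (Turing.TM2OutputsInTime (machine p k₀ k₁) s (some s') (t + 1)) := by
  obtain ⟨n, hn, v, hv⟩ := h.simulate (machine p k₀ k₁).m some none (fun l => rfl)
    (machine p k₀ k₁).initialState
  have h₀ : Turing.initList (machine p k₀ k₁) s =
      ⟨some (some (entry p)), (machine p k₀ k₁).initialState, single k₀ s⟩ := by
    unfold Turing.initList
    congr 1
    refine funext fun (k : K) => ?_
    by_cases hk : k = k₀
    · subst hk
      exact (dif_pos rfl).trans (single_self k _).symm
    · exact (dif_neg hk).trans (single_of_ne hk _).symm
  have h₁ : Turing.haltList (machine p k₀ k₁) s' =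
      ⟨none, (machine p k₀ k₁).initialState, single k₁ s'⟩ := by
    unfold Turing.haltList
    congr 1
    refine funext fun (k : K) => ?_
    by_cases hk : k = k₁
    · subst hk
      exact (dif_pos rfl).trans (single_self k _).symm
    · exact (dif_neg hk).trans (single_of_ne hk _).symm
  refine ⟨⟨⟨1 + n, ?_⟩, (by omega : 1 + n ≤ t + 1)⟩⟩
  refine (congrArg (fun c => (flip bind (machine p k₀ k₁).step)^[1 + n] (some c)) h₀).trans
    (Eq.trans ?_ (congrArg some h₁.symm))
  rw [Function.iterate_add_apply]
  exact congrArg _ hv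

end StackProg

/-! ### Polynomial-time functions on tree-coded data -/

/-- The stacks of the machines below: input, output, two scratch stacks and three value stacks. -/
inductive Stk
  | inp | out | tmp | cnt
  | val (i : Fin 3)
  deriving DecidableEq, Fintype

/-- The alphabets of the stacks. -/
abbrev Stk.Sym : Stk → Type
  | .inp => Γ'
  | .out => Bool
  | .tmp => Bool
  | .cnt => Bool
  | .val _ => Bool

instance Stk.fintypeSym : ∀ k : Stk, Fintype k.Sym
  | .inp => inferInstanceAs (Fintype Γ')
  | .out => inferInstanceAs (Fintype Bool)
  | .tmp => inferInstanceAs (Fintype Bool)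
  | .cnt => inferInstanceAs (Fintype Bool)
  | .val _ => inferInstanceAs (Fintype Bool)

/-- Prefix codes of binary trees, `false` coding a leaf and `true` an inner node. -/
inductive IsTreeCode : List Bool → Prop
  | leaf : IsTreeCode [false]
  | node {a b} : IsTreeCode a → IsTreeCode b → IsTreeCode (true :: (a ++ b))

/-! ### Moving, copying and dropping tree codes on stacks -/

namespace StackProg

open Stk

/-- The stacks with value stacks `v`, scratch stacks `t`, `c`, input stack `x`, output stack `y`. -/
def st (v : Fin 3 → List Bool) (t c : List Bool) (x : List Γ') (y : List Bool) :
    ∀ k : Stk, List k.Sym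
  | .inp => x
  | .out => y
  | .tmp => t
  | .cnt => c
  | .val i => v i

variable {v : Fin 3 → List Bool} {t c : List Bool} {x : List Γ'} {y : List Bool}
  {n : ℕ} {S' : ∀ k : Stk, List k.Sym}

theorem update_val (i : Fin 3) (l : List Bool) :
    Function.update (st v t c x y) (val i) l = st (Function.update v i l) t c x y := by
  funext k
  cases k with
  | val j =>
    by_cases h : j = i
    · subst h; simp [st]
    · rw [Function.update_of_ne (by simpa using h)]
      simp [st, h]
  | _ => rfl

theorem update_tmp (l : List Bool) : Function.update (st v t c x y) tmp l = st v l c x y := by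
  funext k
  cases k <;> rfl

theorem update_cnt (l : List Bool) : Function.update (st v t c x y) cnt l = st v t l x y := by
  funext k
  cases k <;> rfl

theorem update_inp (l : List Γ') : Function.update (st v t c x y) inp l = st v t c l y := by
  funext k
  cases k <;> rfl

theorem update_out (l : List Bool) : Function.update (st v t c x y) out l = st v t c x l := by
  funext k
  cases k <;> rfl

theorem exec_push_val (i : Fin 3) (b : Bool) :
    Exec (push (Γ := Sym) (val i) b) (st v t c x y) 1
      (st (Function.update v i (b :: v i)) t c x y) := by
  have := Exec.push (Γ := Sym) (val i) b (st v t c x y)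
  rwa [update_val] at this

theorem exec_push_tmp (b : Bool) :
    Exec (push (Γ := Sym) tmp b) (st v t c x y) 1 (st v (b :: t) c x y) := by
  have := Exec.push (Γ := Sym) tmp b (st v t c x y)
  rwa [update_tmp] at this

theorem exec_push_cnt (b : Bool) :
    Exec (push (Γ := Sym) cnt b) (st v t c x y) 1 (st v t (b :: c) x y) := by
  have := Exec.push (Γ := Sym) cnt b (st v t c x y)
  rwa [update_cnt] at this

theorem exec_push_out (b : Bool) :
    Exec (push (Γ := Sym) out b) (st v t c x y) 1 (st v t c x (b :: y)) := by
  have := Exec.push (Γ := Sym) out b (st v t c x y)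
  rwa [update_out] at this

theorem exec_case_val {i : Fin 3} {b : Bool} {s : List Bool} {f : Option Bool → StackProg Sym}
    (hv : v i = b :: s) (h : Exec (f (some b)) (st (Function.update v i s) t c x y) n S') :
    Exec (case (Γ := Sym) (val i) f) (st v t c x y) (n + 1) S' := by
  have e : st v t c x y (val i) = b :: s := hv
  apply Exec.case
  rw [e]
  rw [← update_val] at h
  exact h

theorem exec_loop_tmp_nil {p : Option Bool → StackProg Sym} :
    Exec (loop (Γ := Sym) tmp Option.isSome p) (st v [] c x y) 1 (st v [] c x y) := by
  have := Exec.loop_done (Γ := Sym) (k := tmp) (c := Option.isSome) (f := p) (S := st v [] c x y) rfl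
  rwa [update_tmp] at this

theorem exec_loop_tmp_cons {p : Option Bool → StackProg Sym} {b : Bool} {m : ℕ}
    {S : ∀ k : Stk, List k.Sym}
    (h : Exec (p (some b)) (st v t c x y) m S)
    (h' : Exec (loop (Γ := Sym) tmp Option.isSome p) S n S') :
    Exec (loop (Γ := Sym) tmp Option.isSome p) (st v (b :: t) c x y) (m + n + 1) S' := by
  refine Exec.loop_step (k := tmp) rfl ?_ h'
  rw [update_tmp]
  exact h

/-- One step of the parser of a tree code. -/
def grabStep : Option Bool → StackProg Sym
  | some true => seq (push tmp true) (seq (push cnt true) (push cnt true))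
  | some false => push tmp false
  | none => skip

/-- The loop of the parser of a tree code; the stack `cnt` counts the subtrees still expected. -/
def grabLoop (i : Fin 3) : StackProg Sym :=
  loop cnt Option.isSome fun _ => case (val i) grabStep

/-- A leaf uses up one symbol of the counter; an inner node uses up one and puts back two. Tree
codes are therefore self-delimiting and need no end marker. The statement is in continuation form,
from a run after `w` to a run before it, so that the two subtrees of a node chain together. -/
theorem exec_grabLoop (i : Fin 3) {w : List Bool} (hw : IsTreeCode w) :
    ∀ {v : Fin 3 → List Bool} {s t c : List Bool} {n : ℕ}, v i = w ++ s →
      Exec (grabLoop i) (st (Function.update v i s) (w.reverse ++ t) c x y) n S' →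
      Exec (grabLoop i) (st v t (true :: c) x y) (n + 5 * w.length) S' := by
  induction hw with
  | leaf =>
    intro v s t c n hv h
    refine Exec.weaken (Exec.loop_step (k := cnt) rfl ?_ h) (t := 1 + 1 + n + 1)
      (by simp; omega)
    rw [update_cnt]
    exact exec_case_val hv (exec_push_tmp false)
  | @node a b _ _ iha ihb =>
    intro v s t c n hv h
    have h₁ := ihb (v := Function.update (Function.update v i (a ++ (b ++ s))) i (b ++ s))
      (s := s) (t := a.reverse ++ true :: t) (c := c) (n := n) (by simp) (by simpa using h)
    have h₂ := iha (v := Function.update v i (a ++ (b ++ s))) (t := true :: t) (by simp) h₁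
    refine Exec.weaken (Exec.loop_step (k := cnt) rfl ?_ h₂) (t := 1 + (1 + 1) + 1 + _ + 1)
      (by simp; omega)
    rw [update_cnt]
    refine exec_case_val (s := a ++ (b ++ s)) (by simpa using hv) ?_
    exact ((exec_push_tmp true).seq ((exec_push_cnt true).seq (exec_push_cnt true)))

theorem exec_grabLoop_nil (i : Fin 3) :
    Exec (grabLoop i) (st v t [] x y) 1 (st v t [] x y) := by
  have := Exec.loop_done (Γ := Sym) (k := cnt) (c := Option.isSome)
    (f := fun _ => case (val i) grabStep) (S := st v t [] x y) rfl
  rwa [update_cnt] at this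

/-- Move the topmost tree code of the value stack `i` to the scratch stack, reversing it. -/
def grab (i : Fin 3) : StackProg Sym := seq (push cnt true) (grabLoop i)

theorem exec_grab (i : Fin 3) {w s : List Bool} (hw : IsTreeCode w) (hv : v i = w ++ s) :
    Exec (grab i) (st v [] [] x y) (5 * w.length + 2)
      (st (Function.update v i s) w.reverse [] x y) := by
  refine Exec.weaken ((exec_push_cnt true).seq
    (exec_grabLoop i hw (s := s) (n := 1) hv ?_)) (by omega)
  rw [List.append_nil]
  exact exec_grabLoop_nil i

/-- Move the topmost value of the value stack `i` to the value stack `j`. -/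
def mv (i j : Fin 3) : StackProg Sym :=
  seq (grab i) (loop tmp Option.isSome fun b => push (val j) (b.getD false))

/-- Copy the topmost value of the value stack `i` to the value stack `j`. -/
def cp (i j : Fin 3) : StackProg Sym :=
  seq (grab i) (loop tmp Option.isSome fun b =>
    seq (push (val i) (b.getD false)) (push (val j) (b.getD false)))

/-- Remove the topmost value of the value stack `i`. -/
def drop (i : Fin 3) : StackProg Sym := seq (grab i) (loop tmp Option.isSome fun _ => skip)

/-- The grabbed code lies reversed on the scratch stack, and emptying that stack onto another one
restores its order. -/
theorem exec_mv {i j : Fin 3} (hij : i ≠ j) {w s : List Bool} (hw : IsTreeCode w)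
    (hv : v i = w ++ s) :
    Exec (mv i j) (st v [] [] x y) (10 * w.length + 10)
      (st (Function.update (Function.update v i s) j (w ++ v j)) [] [] x y) := by
  have key : ∀ (t : List Bool) (v : Fin 3 → List Bool),
      Exec (loop (Γ := Sym) tmp Option.isSome fun b => push (val j) (b.getD false))
        (st v t [] x y) (2 * t.length + 1)
        (st (Function.update v j (t.reverse ++ v j)) [] [] x y) := by
    intro t
    induction t with
    | nil => intro v; simpa using exec_loop_tmp_nil
    | cons b t ih =>
      intro v
      have := (exec_loop_tmp_cons (exec_push_val (v := v) j b) (ih _)).weaken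
        (t' := 2 * (b :: t).length + 1) (by simp; omega)
      simpa using this
  have := ((exec_grab i hw hv).seq (key _ _)).weaken (t' := 10 * w.length + 10) (by simp; omega)
  simpa [mv, hij.symm] using this

theorem exec_cp {i j : Fin 3} (hij : i ≠ j) {w s : List Bool} (hw : IsTreeCode w)
    (hv : v i = w ++ s) :
    Exec (cp i j) (st v [] [] x y) (10 * w.length + 10)
      (st (Function.update v j (w ++ v j)) [] [] x y) := by
  have key : ∀ (t : List Bool) (v : Fin 3 → List Bool),
      Exec (loop (Γ := Sym) tmp Option.isSome fun b =>
          seq (push (val i) (b.getD false)) (push (val j) (b.getD false)))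
        (st v t [] x y) (3 * t.length + 1)
        (st (Function.update (Function.update v i (t.reverse ++ v i)) j (t.reverse ++ v j))
          [] [] x y) := by
    intro t
    induction t with
    | nil => intro v; simpa using exec_loop_tmp_nil
    | cons b t ih =>
      intro v
      have := (exec_loop_tmp_cons ((exec_push_val (v := v) i b).seq (exec_push_val j b)) (ih _)).weaken
        (t' := 3 * (b :: t).length + 1) (by simp; omega)
      simpa [hij, hij.symm, Function.update_comm hij] using this
  have := ((exec_grab i hw hv).seq (key _ _)).weaken (t' := 10 * w.length + 10) (by simp; omega)
  have e : Function.update v i (w ++ s) = v := by rw [← hv, Function.update_eq_self]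
  simpa [cp, hij, hij.symm, e] using this

theorem exec_drop {i : Fin 3} {w s : List Bool} (hw : IsTreeCode w) (hv : v i = w ++ s) :
    Exec (drop i) (st v [] [] x y) (10 * w.length + 10) (st (Function.update v i s) [] [] x y) := by
  have key : ∀ t : List Bool, ∀ v : Fin 3 → List Bool,
      Exec (loop (Γ := Sym) tmp Option.isSome fun _ => skip)
        (st v t [] x y) (2 * t.length + 1) (st v [] [] x y) := by
    intro t v
    induction t with
    | nil => simpa using exec_loop_tmp_nil
    | cons b t ih => exact (exec_loop_tmp_cons (Exec.skip _) ih).weaken (by simp; omega)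
  exact ((exec_grab i hw hv).seq (key _ _)).weaken (by simp; omega)

end StackProg

/-! ### Codes of data types and their sizes -/

/-- Types whose elements are coded by binary trees, written as strings in prefix notation. -/
class Enc (α : Type) where
  enc : α → List Bool
  isTreeCode : ∀ a, IsTreeCode (enc a)

open Enc

/-- The length of the code of `a`. -/
def size {α : Type} [Enc α] (a : α) : ℕ := (enc a).length

instance : Enc Unit := ⟨fun _ => [false], fun _ => .leaf⟩

/-- These are the codes of `[()]` and `[]`, so that branching on a truth value becomes case
distinction on a list. -/
instance : Enc Bool :=
  ⟨fun b => if b then [true, false, false] else [false], fun b => by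
    cases b
    exacts [.leaf, .node (a := [false]) (b := [false]) .leaf .leaf]⟩

instance {α β : Type} [Enc α] [Enc β] : Enc (α × β) :=
  ⟨fun x => true :: (enc x.1 ++ enc x.2), fun x => .node (isTreeCode x.1) (isTreeCode x.2)⟩

/-- The code of a list. -/
def encList {α : Type} [Enc α] : List α → List Bool
  | [] => [false]
  | a :: l => true :: (enc a ++ encList l)

instance {α : Type} [Enc α] : Enc (List α) :=
  ⟨encList, fun l => by
    induction l with
    | nil => exact .leaf
    | cons a l ih => exact .node (isTreeCode a) ih⟩

/-- Unary suffices for vertex numbers and lengths, and it makes a number a ready-made list to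
iterate over. Weights are kept as lists of binary digits instead. -/
instance : Enc ℕ := ⟨fun n => enc (List.replicate n ()), fun n => isTreeCode (List.replicate n ())⟩

section size

variable {α β : Type} [Enc α] [Enc β]

theorem enc_prod (a : α) (b : β) : enc (a, b) = true :: (enc a ++ enc b) := rfl

theorem enc_nil : enc ([] : List α) = [false] := rfl

theorem enc_cons (a : α) (l : List α) : enc (a :: l) = true :: (enc a ++ enc l) := rfl

theorem size_prod (a : α) (b : β) : size (a, b) = 1 + size a + size b := by
  simp [size, enc_prod]; omega

theorem size_nil : size ([] : List α) = 1 := rfl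

theorem size_cons (a : α) (l : List α) : size (a :: l) = 1 + size a + size l := by
  simp [size, enc_cons]; omega

theorem size_pos (a : α) : 0 < size a := by
  have h := isTreeCode a
  unfold size
  generalize enc a = w at h
  cases h <;> simp

theorem size_append (l l' : List α) : size (l ++ l') + 1 = size l + size l' := by
  induction l with
  | nil => simp [size_nil]; omega
  | cons a l ih => simp only [List.cons_append, size_cons]; omega

theorem size_le_of_sublist {l l' : List α} (h : l.Sublist l') : size l ≤ size l' := by
  induction h with
  | slnil => exact le_rfl
  | cons a _ ih => rw [size_cons]; omega
  | cons_cons a _ ih => rw [size_cons, size_cons]; omega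

theorem size_le_of_mem {a : α} {l : List α} (h : a ∈ l) : size a ≤ size l := by
  have := size_le_of_sublist (List.singleton_sublist.2 h)
  rw [size_cons] at this
  omega

theorem length_le_size (l : List α) : l.length ≤ size l := by
  induction l with
  | nil => simp
  | cons a l ih => rw [size_cons, List.length_cons]; omega

/-- A list of at most `n` elements of size at most `s` each has size at most `n * (s + 1) + 1`. -/
theorem size_list_le {l : List α} {n s : ℕ} (hn : l.length ≤ n) (hs : ∀ a ∈ l, size a ≤ s) :
    size l ≤ n * (s + 1) + 1 := by
  have : size l ≤ l.length * (s + 1) + 1 := by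
    clear hn
    induction l with
    | nil => simp [size_nil]
    | cons a l ih =>
      have h₁ := ih fun b hb => hs b (List.mem_cons_of_mem _ hb)
      have h₂ := hs a List.mem_cons_self
      rw [size_cons, List.length_cons, Nat.succ_mul]
      omega
  exact this.trans (by gcongr)

end size

/-! ### Polynomial bounds -/

/-- `t a` is bounded by a polynomial in the size of `a`. -/
def PolyBounded {α : Type} [Enc α] (t : α → ℕ) : Prop :=
  ∃ p : Polynomial ℕ, ∀ a, t a ≤ p.eval (size a)

namespace PolyBounded

variable {α β : Type} [Enc α] [Enc β] {s t : α → ℕ}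

theorem eval_mono (p : Polynomial ℕ) : Monotone fun n : ℕ => p.eval n := by
  intro m n h
  simp only [Polynomial.eval_eq_sum_range]
  gcongr

theorem mono (ht : PolyBounded t) (h : ∀ a, s a ≤ t a) : PolyBounded s :=
  let ⟨p, hp⟩ := ht
  ⟨p, fun a => (h a).trans (hp a)⟩

theorem const (n : ℕ) : PolyBounded fun _ : α => n := ⟨Polynomial.C n, fun a => by simp⟩

theorem size : PolyBounded fun a : α => size a := ⟨Polynomial.X, fun a => by simp⟩

theorem add (hs : PolyBounded s) (ht : PolyBounded t) : PolyBounded fun a => s a + t a :=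
  let ⟨p, hp⟩ := hs
  let ⟨q, hq⟩ := ht
  ⟨p + q, fun a => by simpa using add_le_add (hp a) (hq a)⟩

theorem mul (hs : PolyBounded s) (ht : PolyBounded t) : PolyBounded fun a => s a * t a :=
  let ⟨p, hp⟩ := hs
  let ⟨q, hq⟩ := ht
  ⟨p * q, fun a => by simpa using Nat.mul_le_mul (hp a) (hq a)⟩

theorem eval (p : Polynomial ℕ) (ht : PolyBounded t) : PolyBounded fun a => p.eval (t a) :=
  let ⟨q, hq⟩ := ht
  ⟨p.comp q, fun a => by simpa using eval_mono p (hq a)⟩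

theorem comp {u : β → ℕ} {g : α → β} (hu : PolyBounded u) (hg : PolyBounded fun a => _root_.size (g a)) :
    PolyBounded fun a => u (g a) :=
  let ⟨p, hp⟩ := hu
  (hg.eval p).mono fun a => hp (g a)

end PolyBounded

/-! ### Functions computable in polynomial time and their closure properties -/

open StackProg Stk

/-- `f` is computed in polynomial time by a program that replaces the topmost value `a` of the
first value stack by `f a`, whatever lies below it and on the other value stacks. -/
@[fun_prop]
def PT {α β : Type} [Enc α] [Enc β] (f : α → β) : Prop :=
  ∃ P : StackProg Sym, ∃ t : α → ℕ, PolyBounded t ∧ ∀ a s r q x y,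
    Exec P (st ![enc a ++ s, r, q] [] [] x y) (t a) (st ![enc (f a) ++ s, r, q] [] [] x y)

namespace StackProg

variable {α : Type} [Enc α] {a : α} {s r q : List Bool} {x : List Γ'} {y : List Bool}

theorem update₀ (m r q s : List Bool) : Function.update ![m, r, q] 0 s = ![s, r, q] := by
  funext i; fin_cases i <;> rfl

theorem update₁ (m r q s : List Bool) : Function.update ![m, r, q] 1 s = ![m, s, q] := by
  funext i; fin_cases i <;> rfl

theorem update₂ (m r q s : List Bool) : Function.update ![m, r, q] 2 s = ![m, r, s] := by
  funext i; fin_cases i <;> rfl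

theorem exec_push₀ (b : Bool) :
    Exec (push (val 0) b) (st ![s, r, q] [] [] x y) 1 (st ![b :: s, r, q] [] [] x y) := by
  simpa [update₀] using exec_push_val (v := ![s, r, q]) (t := []) (c := []) (x := x) (y := y) 0 b

theorem exec_case₀ {b : Bool} {f : Option Bool → StackProg Sym} {n : ℕ}
    {S' : ∀ k : Stk, List k.Sym}
    (h : Exec (f (some b)) (st ![s, r, q] [] [] x y) n S') :
    Exec (case (val 0) f) (st ![b :: s, r, q] [] [] x y) (n + 1) S' :=
  exec_case_val (s := s) rfl (by simpa [update₀] using h)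

theorem exec_mv₀₁ : Exec (mv 0 1) (st ![enc a ++ s, r, q] [] [] x y) (10 * size a + 10)
    (st ![s, enc a ++ r, q] [] [] x y) := by
  simpa [size, update₀, update₁, update₂] using exec_mv (v := ![enc a ++ s, r, q]) (x := x) (y := y) (i := 0) (j := 1) (by decide)
    (isTreeCode a) rfl

theorem exec_mv₁₀ : Exec (mv 1 0) (st ![s, enc a ++ r, q] [] [] x y) (10 * size a + 10)
    (st ![enc a ++ s, r, q] [] [] x y) := by
  simpa [size, update₀, update₁, update₂] using exec_mv (v := ![s, enc a ++ r, q]) (x := x) (y := y) (i := 1) (j := 0) (by decide)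
    (isTreeCode a) rfl

theorem exec_mv₂₀ : Exec (mv 2 0) (st ![s, r, enc a ++ q] [] [] x y) (10 * size a + 10)
    (st ![enc a ++ s, r, q] [] [] x y) := by
  simpa [size, update₀, update₁, update₂] using exec_mv (v := ![s, r, enc a ++ q]) (x := x) (y := y) (i := 2) (j := 0) (by decide)
    (isTreeCode a) rfl

theorem exec_cp₀₂ : Exec (cp 0 2) (st ![enc a ++ s, r, q] [] [] x y) (10 * size a + 10)
    (st ![enc a ++ s, r, enc a ++ q] [] [] x y) := by
  simpa [size, update₀, update₁, update₂] using exec_cp (v := ![enc a ++ s, r, q]) (x := x) (y := y) (i := 0) (j := 2) (by decide)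
    (isTreeCode a) rfl

theorem exec_cp₂₀ : Exec (cp 2 0) (st ![s, r, enc a ++ q] [] [] x y) (10 * size a + 10)
    (st ![enc a ++ s, r, enc a ++ q] [] [] x y) := by
  simpa [size, update₀, update₁, update₂] using exec_cp (v := ![s, r, enc a ++ q]) (x := x) (y := y) (i := 2) (j := 0) (by decide)
    (isTreeCode a) rfl

theorem exec_drop₀ : Exec (drop 0) (st ![enc a ++ s, r, q] [] [] x y) (10 * size a + 10)
    (st ![s, r, q] [] [] x y) := by
  simpa [size, update₀, update₁, update₂] using exec_drop (v := ![enc a ++ s, r, q]) (x := x) (y := y) (i := 0)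
    (isTreeCode a) rfl

/-- Push a string on the first value stack. -/
def pushList : List Bool → StackProg Sym
  | [] => skip
  | b :: l => seq (pushList l) (push (val 0) b)

theorem exec_pushList (l : List Bool) :
    Exec (pushList l) (st ![s, r, q] [] [] x y) (l.length + 1)
      (st ![l ++ s, r, q] [] [] x y) := by
  induction l with
  | nil => exact Exec.skip _
  | cons b l ih => exact ih.seq (exec_push₀ b)

/-- A push costs one unit of time, so a stack grows by at most the running time. This is why
polynomial time entails polynomial output size. -/
theorem Exec.length_le {K : Type} {Γ : K → Type} [DecidableEq K] {p : StackProg Γ}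
    {S S' : ∀ k, List (Γ k)} {t : ℕ} (h : Exec p S t S') (k : K) :
    (S' k).length ≤ (S k).length + t := by
  have tail_le : ∀ (S : ∀ k, List (Γ k)) (j : K),
      (Function.update S j (S j).tail k).length ≤ (S k).length := by
    intro S j
    by_cases hk : k = j
    · subst hk; simp
    · simp [hk]
  induction h with
  | skip => omega
  | push j a S =>
    by_cases hk : k = j
    · subst hk; simp
    · simp [hk]
  | seq _ _ ih₁ ih₂ => omega
  | @case j f S _ _ _ ih => have := tail_le S j; omega
  | @loop_done j _ _ S => have := tail_le S j; omega
  | @loop_step j _ _ S _ _ _ _ _ _ _ ih₁ ih₂ => have := tail_le S j; omega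
  | weaken _ _ ih => omega

end StackProg

namespace PT

variable {α β γ σ : Type} [Enc α] [Enc β] [Enc γ] [Enc σ]

theorem polyBounded_size {f : α → β} (hf : PT f) : PolyBounded fun a => size (f a) := by
  obtain ⟨P, t, ht, h⟩ := hf
  refine (PolyBounded.size.add ht).mono fun a => ?_
  simpa [st, size] using (h a [] [] [] [] []).length_le (val 0)

/-- Programs see codes only, so values of different types with equal codes are interchangeable. -/
theorem congr_enc {β' : Type} [Enc β'] {f : α → β} {f' : α → β'} (hf : PT f)
    (h : ∀ a, enc (f' a) = enc (f a)) : PT f' := by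
  obtain ⟨P, t, ht, hP⟩ := hf
  exact ⟨P, t, ht, fun a => by rw [h]; exact hP a⟩

theorem of_eq {f f' : α → β} (hf : PT f) (h : ∀ a, f' a = f a) : PT f' :=
  hf.congr_enc fun a => by rw [h]

@[fun_prop]
theorem id : PT fun a : α => a :=
  ⟨skip, fun _ => 1, .const 1, fun _ _ _ _ _ _ => Exec.skip _⟩

@[fun_prop]
theorem comp {g : β → γ} {f : α → β} (hg : PT g) (hf : PT f) : PT fun a => g (f a) := by
  have hsz := hf.polyBounded_size
  obtain ⟨P, t, ht, hP⟩ := hf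
  obtain ⟨Q, u, hu, hQ⟩ := hg
  exact ⟨seq P Q, fun a => t a + u (f a), ht.add (hu.comp hsz),
    fun a s r q x y => (hP a s r q x y).seq (hQ (f a) s r q x y)⟩

@[fun_prop]
theorem const (b : β) : PT fun _ : α => b :=
  ⟨seq (drop 0) (pushList (enc b)), fun a => (10 * size a + 10) + ((enc b).length + 1),
    (((PolyBounded.const 10).mul .size).add (.const 10)).add (.const _),
    fun _ _ _ _ _ _ => exec_drop₀.seq (exec_pushList _)⟩

@[fun_prop]
theorem prodMk {f : α → β} {g : α → γ} (hf : PT f) (hg : PT g) : PT fun a => (f a, g a) := by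
  obtain ⟨P, t, ht, hP⟩ := hf
  obtain ⟨Q, u, hu, hQ⟩ := hg
  -- `Q` runs first because the code of the pair has `f a` on top. The copy of `a` waits on the
  -- third stack, which `Q` leaves intact.
  refine ⟨seq (cp 0 2) (seq Q (seq (mv 2 0) (seq P (push (val 0) true)))),
    fun a => (10 * size a + 10) + (u a + ((10 * size a + 10) + (t a + 1))), ?_, ?_⟩
  · have h₀ : PolyBounded fun a : α => 10 * size a + 10 :=
      ((PolyBounded.const 10).mul .size).add (.const 10)
    exact h₀.add (hu.add (h₀.add (ht.add (.const 1))))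
  · intro a s r q x y
    refine exec_cp₀₂.seq ((hQ a _ _ _ _ _).seq (exec_mv₂₀.seq ((hP a _ _ _ _ _).seq ?_)))
    have := exec_push₀ (s := enc (f a) ++ (enc (g a) ++ s)) (r := r) (q := q) (x := x) (y := y) true
    rw [enc_prod, List.cons_append, List.append_assoc]
    exact this

theorem snd' : PT (Prod.snd : α × β → β) := by
  refine ⟨case (val 0) fun _ => drop 0, fun x => (10 * size x + 10) + 1,
    (((PolyBounded.const 10).mul .size).add (.const 10)).add (.const _), ?_⟩
  rintro ⟨a, b⟩ s r q x y
  rw [enc_prod, List.cons_append, List.append_assoc]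
  exact exec_case₀ (exec_drop₀.weaken (by rw [size_prod]; omega))

theorem fst' : PT (Prod.fst : α × β → α) := by
  refine ⟨case (val 0) fun _ => seq (mv 0 1) (seq (drop 0) (mv 1 0)),
    fun x => ((10 * size x + 10) + ((10 * size x + 10) + (10 * size x + 10))) + 1, ?_, ?_⟩
  · have h₀ : PolyBounded fun a : α × β => 10 * size a + 10 :=
      ((PolyBounded.const 10).mul .size).add (.const 10)
    exact (h₀.add (h₀.add h₀)).add (.const 1)
  · rintro ⟨a, b⟩ s r q x y
    rw [enc_prod, List.cons_append, List.append_assoc]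
    exact exec_case₀ ((exec_mv₀₁.seq (exec_drop₀.seq exec_mv₁₀)).weaken (by rw [size_prod]; omega))

@[fun_prop]
theorem fst {f : α → β × γ} (hf : PT f) : PT fun a => (f a).1 := fst'.comp hf

@[fun_prop]
theorem snd {f : α → β × γ} (hf : PT f) : PT fun a => (f a).2 := snd'.comp hf

@[fun_prop]
theorem cons {f : α → β} {g : α → List β} (hf : PT f) (hg : PT g) : PT fun a => f a :: g a :=
  (hf.prodMk hg).congr_enc fun _ => rfl

/-- Case distinction on a list. -/
theorem listCases {f : α → List β} {g : α → γ} {h : α → β → List β → γ} (hf : PT f) (hg : PT g)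
    (hh : PT fun x : α × (β × List β) => h x.1 x.2.1 x.2.2) :
    PT fun a => List.casesOn (motive := fun _ => γ) (f a) (g a) (h a) := by
  have hsz : PolyBounded fun a => size (a, f a) := (prodMk id hf).polyBounded_size
  obtain ⟨F, t, ht, hF⟩ := prodMk id hf
  obtain ⟨G, u, hu, hG⟩ := hg
  obtain ⟨H, ⟨w, ⟨p, hp⟩, hH⟩⟩ := hh
  -- With `a` parked on the second stack, the leading symbol of `f a` tells whether the list is
  -- empty. If not, what remains is the codes of `b` and `l`; the two pushed tags turn them,
  -- together with `a`, into the code of `(a, (b, l))`.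
  refine ⟨seq F (case (val 0) fun _ => seq (mv 0 1) (case (val 0) fun b =>
      if b = some true then seq (push (val 0) true) (seq (mv 1 0) (seq (push (val 0) true) H))
      else seq (mv 1 0) G)),
    fun a => t a + (((10 * size (a, f a) + 10) + ((1 + ((10 * size (a, f a) + 10) +
      (1 + p.eval (size (a, f a)) + u a))) + 1)) + 1), ?_, ?_⟩
  · have h₀ : PolyBounded fun a => 10 * size (a, f a) + 10 :=
      ((PolyBounded.const 10).mul hsz).add (.const 10)
    exact ht.add ((h₀.add (((PolyBounded.const 1).add (h₀.add
      (((PolyBounded.const 1).add (hsz.eval p)).add hu))).add (.const 1))).add (.const 1))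
  · intro a s r q x y
    dsimp only
    refine (hF a s r q x y).seq ?_
    rw [enc_prod, List.cons_append, List.append_assoc]
    have hsz := size_prod a (f a)
    refine exec_case₀ ((exec_mv₀₁.weaken (by omega)).seq ?_)
    generalize f a = l at hsz ⊢
    rcases l with _ | ⟨b, l⟩
    · rw [enc_nil, List.cons_append, List.nil_append]
      refine exec_case₀ ?_
      rw [if_neg (by simp)]
      exact Exec.weaken (Exec.seq exec_mv₁₀ (hG a s r q x y)) (by omega)
    · rw [enc_cons, List.cons_append, List.append_assoc]
      refine exec_case₀ ?_
      rw [if_pos rfl]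
      have h₁ := hH (a, (b, l)) s r q x y
      have h₂ := hp (a, (b, l))
      have h₃ : size (a, (b, l)) = size (a, b :: l) := by
        simp only [size_prod, size_cons]
      have h₄ := PolyBounded.eval_mono p (show size (a, (b, l)) ≤ size (a, b :: l) by omega)
      simp only [enc_prod, List.cons_append, List.append_assoc] at h₁
      refine Exec.weaken ((exec_push₀ true).seq (exec_mv₁₀.seq ((exec_push₀ true).seq h₁))) ?_
      dsimp only at h₄
      omega

end PT

namespace StackProg

theorem exec_loop₁_nil {p : Option Bool → StackProg Sym} {s r q : List Bool} {x : List Γ'}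
    {y : List Bool} :
    Exec (loop (Γ := Sym) (val 1) (fun b => b == some true) p) (st ![s, false :: r, q] [] [] x y) 1
      (st ![s, r, q] [] [] x y) := by
  have := Exec.loop_done (Γ := Sym) (k := val 1) (c := fun b => b == some true) (f := p)
    (S := st ![s, false :: r, q] [] [] x y) rfl
  rw [update_val] at this
  simpa [update₁, st] using this

theorem exec_loop₁_cons {p : Option Bool → StackProg Sym} {s r q : List Bool} {x : List Γ'}
    {y : List Bool} {m n : ℕ} {S S' : ∀ k : Stk, List k.Sym}
    (h : Exec (p (some true)) (st ![s, r, q] [] [] x y) m S)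
    (h' : Exec (loop (Γ := Sym) (val 1) (fun b => b == some true) p) S n S') :
    Exec (loop (Γ := Sym) (val 1) (fun b => b == some true) p) (st ![s, true :: r, q] [] [] x y)
      (m + n + 1) S' := by
  refine Exec.loop_step (k := val 1) rfl ?_ h'
  rw [update_val]
  simpa [update₁, st] using h

end StackProg

/-! ### Folds over lists -/

namespace PT

variable {α β γ σ : Type} [Enc α] [Enc β] [Enc γ] [Enc σ]

/-- Iteration along a list, provided that the intermediate results have polynomial size. -/
theorem foldl {f : α → List β} {g : α → σ} {h : α → σ → β → σ} (hf : PT f) (hg : PT g)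
    (hh : PT fun x : α × (β × σ) => h x.1 x.2.2 x.2.1) {u : α → ℕ} (hu : PolyBounded u)
    (hb : ∀ a l₁ l₂, f a = l₁ ++ l₂ → size (l₁.foldl (h a) (g a)) ≤ u a) :
    PT fun a => (f a).foldl (h a) (g a) := by
  have hfs := hf.polyBounded_size
  obtain ⟨F, tf, htf, hF⟩ := hf
  obtain ⟨G, tg, htg, hG⟩ := hg
  obtain ⟨H, ⟨w, ⟨p, hp⟩, hH⟩⟩ := hh
  -- `B a` bounds every value that is moved, as well as the argument `(a, (b, c))` of each call of
  -- `H`. Without the bound `u`, repeated polynomial growth could become exponential.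
  let B : α → ℕ := fun a => size a + size (f a) + u a + 2
  have hB : PolyBounded B := ((PolyBounded.size.add hfs).add hu).add (.const 2)
  have h₀ : PolyBounded fun a => 10 * B a + 10 := ((PolyBounded.const 10).mul hB).add (.const 10)
  let T : α → ℕ := fun a => (10 * B a + 10) + (1 + ((10 * B a + 10) + (1 + p.eval (B a))))
  have hT : PolyBounded T :=
    h₀.add ((PolyBounded.const 1).add (h₀.add ((PolyBounded.const 1).add (hB.eval p))))
  -- The accumulator is on the first stack, the unread list on the second, `a` on the third. The
  -- loop test has popped the tag of the list, so the next element is exposed; the two pushes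
  -- assemble the input of `H`.
  let body : StackProg Sym :=
    seq (mv 1 0) (seq (push (val 0) true) (seq (cp 2 0) (seq (push (val 0) true) H)))
  have hsa : ∀ a, size a ≤ B a := fun a => by dsimp only [B]; omega
  have hsf : ∀ a, size (f a) ≤ B a := fun a => by dsimp only [B]; omega
  have key : ∀ a s r q x y l₂ l₁, f a = l₁ ++ l₂ →
      Exec (loop (Γ := Sym) (val 1) (fun b => b == some true) fun _ => body)
        (st ![enc (l₁.foldl (h a) (g a)) ++ s, enc l₂ ++ r, enc a ++ q] [] [] x y)
        (l₂.length * (T a + 1) + 1)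
        (st ![enc ((f a).foldl (h a) (g a)) ++ s, r, enc a ++ q] [] [] x y) := by
    intro a s r q x y l₂
    induction l₂ with
    | nil =>
      intro l₁ e
      rw [List.append_nil] at e
      rw [e, enc_nil]
      exact exec_loop₁_nil.weaken (by simp)
    | cons b l ih =>
      intro l₁ e
      have ih' := ih (l₁ ++ [b]) (by simp [e])
      rw [List.foldl_append, List.foldl_cons, List.foldl_nil] at ih'
      have h₁ := hb a l₁ _ e
      have h₂ : size b ≤ size (f a) := size_le_of_mem (by simp [e])
      generalize l₁.foldl (h a) (g a) = c at ih' h₁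
      have h₃ := hH (a, (b, c)) s (enc l ++ r) (enc a ++ q) x y
      have h₄ : size (a, (b, c)) ≤ B a := by simp only [size_prod, B]; omega
      have h₅ := (hp (a, (b, c))).trans (PolyBounded.eval_mono p h₄)
      simp only [enc_prod, List.cons_append, List.append_assoc] at h₃
      rw [enc_cons, List.cons_append, List.append_assoc]
      refine (exec_loop₁_cons (m := T a) ?_ ih').weaken ?_
      · exact (exec_mv₁₀.weaken (by have := hsf a; omega)).seq ((exec_push₀ true).seq
          ((exec_cp₂₀.weaken (by have := hsa a; omega)).seq ((exec_push₀ true).seq (h₃.weaken h₅))))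
      · rw [List.length_cons, Nat.succ_mul]; omega
  refine ⟨seq (cp 0 2) (seq G (seq (cp 2 0) (seq F (seq (mv 0 1)
    (seq (loop (Γ := Sym) (val 1) (fun b => b == some true) fun _ => body)
      (seq (mv 2 0) (drop 0))))))),
    fun a => (10 * B a + 10) + (tg a + ((10 * B a + 10) + (tf a + ((10 * B a + 10) +
      ((size (f a) * (T a + 1) + 1) + ((10 * B a + 10) + (10 * B a + 10))))))), ?_, ?_⟩
  · exact h₀.add (htg.add (h₀.add (htf.add (h₀.add
      (((hfs.mul (hT.add (.const 1))).add (.const 1)).add (h₀.add h₀))))))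
  · intro a s r q x y
    have hsa' : 10 * size a + 10 ≤ 10 * B a + 10 := by have := hsa a; omega
    have hsf' : 10 * size (f a) + 10 ≤ 10 * B a + 10 := by have := hsf a; omega
    refine (exec_cp₀₂.weaken hsa').seq ((hG a _ _ _ _ _).seq ((exec_cp₂₀.weaken hsa').seq
      ((hF a _ _ _ _ _).seq ((exec_mv₀₁.weaken hsf').seq (Exec.seq ((key a _ _ _ _ _ (f a) []
        rfl).weaken ?_) ((exec_mv₂₀.weaken hsa').seq (exec_drop₀.weaken hsa')))))))
    gcongr
    exact length_le_size _

@[fun_prop]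
theorem reverse {f : α → List β} (hf : PT f) : PT fun a => (f a).reverse := by
  refine (foldl hf (const []) (h := fun _ s b => b :: s) (u := fun a => size (f a)) (by fun_prop)
    hf.polyBounded_size ?_).of_eq fun a => by simp
  intro a l₁ l₂ e
  have h₁ : size l₁.reverse = size l₁ := by
    clear e
    induction l₁ with
    | nil => rfl
    | cons b l ih =>
      have := size_append l.reverse [b]
      rw [List.reverse_cons, size_cons]
      rw [size_cons, size_nil] at this
      omega
  have := size_append l₁ l₂
  have := size_pos l₂
  rw [List.foldl_flip_cons_eq_append', List.append_nil, h₁, e]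
  omega

theorem foldr {f : α → List β} {g : α → σ} {h : α → β → σ → σ} (hf : PT f) (hg : PT g)
    (hh : PT fun x : α × (β × σ) => h x.1 x.2.1 x.2.2) {u : α → ℕ} (hu : PolyBounded u)
    (hb : ∀ a l₁ l₂, f a = l₁ ++ l₂ → size (l₂.foldr (h a) (g a)) ≤ u a) :
    PT fun a => (f a).foldr (h a) (g a) := by
  refine (foldl hf.reverse hg (h := fun a s b => h a b s) hh hu ?_).of_eq fun a => by simp
  intro a l₁ l₂ e
  simpa using hb a l₂.reverse l₁.reverse (by simpa using congrArg List.reverse e)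

@[fun_prop]
theorem append {f g : α → List β} (hf : PT f) (hg : PT g) : PT fun a => f a ++ g a := by
  refine (foldr hf hg (h := fun _ b s => b :: s) (u := fun a => size (f a) + size (g a))
    (by fun_prop) (hf.polyBounded_size.add hg.polyBounded_size) ?_).of_eq fun a => by simp
  intro a l₁ l₂ e
  have h₁ := size_append l₁ l₂
  have h₂ := size_append l₂ (g a)
  have h₃ := size_pos l₁
  rw [List.foldr_cons_eq_append', e]
  simp
  omega

end PT

/-! ### Truth values, list operations and unary numbers -/

namespace PT

variable {α β γ σ : Type} [Enc α] [Enc β] [Enc γ] [Enc σ]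

@[fun_prop]
theorem ite {c : α → Bool} {f g : α → β} (hc : PT c) (hf : PT f) (hg : PT g) :
    PT fun a => if c a then f a else g a := by
  have hc' : PT fun a => if c a then [()] else [] := by
    refine hc.congr_enc fun a => ?_
    cases c a <;> rfl
  refine (listCases hc' hg (h := fun a _ _ => f a) (hf.comp fst')).of_eq fun a => ?_
  cases c a <;> rfl

/-- Every binary operation on truth values is computable. -/
theorem bool₂ (op : Bool → Bool → Bool) {f g : α → Bool} (hf : PT f) (hg : PT g) :
    PT fun a => op (f a) (g a) := by
  refine (hf.ite (hg.ite (const (op true true)) (const (op true false)))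
    (hg.ite (const (op false true)) (const (op false false)))).of_eq fun a => ?_
  cases f a <;> cases g a <;> rfl

@[fun_prop]
theorem and {f g : α → Bool} (hf : PT f) (hg : PT g) : PT fun a => f a && g a := bool₂ _ hf hg

@[fun_prop]
theorem or {f g : α → Bool} (hf : PT f) (hg : PT g) : PT fun a => f a || g a := bool₂ _ hf hg

@[fun_prop]
theorem xor {f g : α → Bool} (hf : PT f) (hg : PT g) : PT fun a => f a ^^ g a := bool₂ _ hf hg

@[fun_prop]
theorem not {f : α → Bool} (hf : PT f) : PT fun a => !f a := bool₂ (fun a _ => !a) hf hf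

@[fun_prop]
theorem isEmpty {f : α → List β} (hf : PT f) : PT fun a => (f a).isEmpty := by
  refine (listCases hf (const true) (h := fun _ _ _ => false) (by fun_prop)).of_eq fun a => ?_
  cases f a <;> rfl

@[fun_prop]
theorem tail {f : α → List β} (hf : PT f) : PT fun a => (f a).tail := by
  refine (listCases hf (const []) (h := fun _ _ l => l) (by fun_prop)).of_eq fun a => ?_
  cases f a <;> rfl

@[fun_prop]
theorem headD {f : α → List β} {g : α → β} (hf : PT f) (hg : PT g) :
    PT fun a => (f a).headD (g a) := by
  refine (listCases hf hg (h := fun _ b _ => b) (by fun_prop)).of_eq fun a => ?_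
  cases f a <;> rfl

theorem flatMap {f : α → List β} {h : α → β → List γ} (hf : PT f)
    (hh : PT fun x : α × β => h x.1 x.2) : PT fun a => (f a).flatMap (h a) := by
  obtain ⟨p, hp⟩ := hh.polyBounded_size
  have hfs := hf.polyBounded_size
  -- `1 + size a + size (f a)` bounds the size of `(a, b)` for every element `b` of `f a`.
  let B : α → ℕ := fun a => p.eval (1 + size a + size (f a))
  have hB : PolyBounded B := (((PolyBounded.const 1).add .size).add hfs).eval p
  refine (foldr hf (const []) (h := fun a b s => h a b ++ s)
    (u := fun a => size (f a) * (B a + 1) + 1) (append (hh.comp (by fun_prop :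
      PT fun x : α × (β × List γ) => (x.1, x.2.1))) (by fun_prop))
    ((hfs.mul (hB.add (.const 1))).add (.const 1)) ?_).of_eq fun a => ?_
  · intro a l₁ l₂ e
    have h₁ : ∀ l : List β, (∀ b ∈ l, b ∈ f a) →
        size (l.foldr (fun b s => h a b ++ s) []) ≤ l.length * (B a + 1) + 1 := by
      intro l
      induction l with
      | nil => intro _; simp [size_nil]
      | cons b l ih =>
        intro hl
        have h₂ := ih fun c hc => hl c (List.mem_cons_of_mem _ hc)
        have h₃ := size_append (h a b) (l.foldr (fun b s => h a b ++ s) [])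
        have h₄ : size (h a b) ≤ B a := (hp (a, b)).trans (PolyBounded.eval_mono p (by
          have := size_le_of_mem (hl b List.mem_cons_self)
          rw [size_prod]; omega))
        rw [List.length_cons, Nat.succ_mul, List.foldr_cons]
        omega
    refine (h₁ l₂ (by simp [e]; tauto)).trans ?_
    gcongr
    refine le_trans ?_ (length_le_size (f a))
    simp [e]
  · induction f a with
    | nil => rfl
    | cons b l ih => simp [ih]

theorem map {f : α → List β} {h : α → β → γ} (hf : PT f) (hh : PT fun x : α × β => h x.1 x.2) :
    PT fun a => (f a).map (h a) :=
  (flatMap hf (h := fun a b => [h a b]) (cons hh (const []))).of_eq fun a => by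
    induction f a with
    | nil => rfl
    | cons b l ih => simp [ih]

theorem filter {f : α → List β} {h : α → β → Bool} (hf : PT f)
    (hh : PT fun x : α × β => h x.1 x.2) : PT fun a => (f a).filter (h a) :=
  (flatMap hf (h := fun a b => if h a b then [b] else [])
    (ite hh (cons snd' (const [])) (const []))).of_eq fun a => by
      induction f a with
      | nil => rfl
      | cons b l ih => by_cases hb : h a b <;> simp [ih, hb]

theorem all {f : α → List β} {h : α → β → Bool} (hf : PT f)
    (hh : PT fun x : α × β => h x.1 x.2) : PT fun a => (f a).all (h a) :=
  (isEmpty (filter hf (h := fun a b => !h a b) hh.not)).of_eq fun a => by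
    induction f a with
    | nil => rfl
    | cons b l ih => by_cases hb : h a b <;> simp [ih, hb]

theorem any {f : α → List β} {h : α → β → Bool} (hf : PT f)
    (hh : PT fun x : α × β => h x.1 x.2) : PT fun a => (f a).any (h a) :=
  (all hf (h := fun a b => !h a b) hh.not).not.of_eq fun a => by
    rw [List.any_eq_not_all_not]

@[fun_prop]
-- A unary number has the code of a list of units, along which `tail` is iterated.
theorem listDrop {n : α → ℕ} {f : α → List β} (hn : PT n) (hf : PT f) :
    PT fun a => (f a).drop (n a) := by
  have drop_eq : ∀ (n : ℕ) (l : List β),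
      (List.replicate n ()).foldl (fun l _ => l.tail) l = l.drop n := by
    intro n
    induction n with
    | zero => intro l; rfl
    | succ n ih => intro l; rw [List.replicate_succ, List.foldl_cons, ih]; cases l <;> simp
  refine (foldl (hn.congr_enc (f' := fun a => List.replicate (n a) ()) fun _ => rfl) hf
    (h := fun _ s _ => s.tail) (by fun_prop) hf.polyBounded_size ?_).of_eq
    fun a => (drop_eq _ _).symm
  intro a l₁ l₂ _
  rw [List.eq_replicate_of_mem (a := ()) (l := l₁) (fun _ _ => rfl), drop_eq]
  exact size_le_of_sublist (List.drop_sublist _ _)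

@[fun_prop]
-- Two numbers are equal when dropping either one from the unary list of the other leaves nothing.
theorem natBEq {m n : α → ℕ} (hm : PT m) (hn : PT n) : PT fun a => m a == n a := by
  have h : ∀ f : α → ℕ, PT f → PT fun a => List.replicate (f a) () :=
    fun f hf => hf.congr_enc fun _ => rfl
  refine (and (isEmpty (listDrop hm (h n hn))) (isEmpty (listDrop hn (h m hm)))).of_eq fun a => ?_
  rw [Bool.eq_iff_iff]
  simp
  omega

@[fun_prop]
theorem length {f : α → List β} (hf : PT f) : PT fun a => (f a).length :=
  (map hf (h := fun _ _ => ()) (const ())).congr_enc fun a => by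
    rw [List.map_const']; rfl

end PT

/-! ### Binary arithmetic -/

/-- The number with the given binary digits, least significant digit first. -/
def bitsVal : List Bool → ℕ
  | [] => 0
  | b :: l => b.toNat + 2 * bitsVal l

theorem bitsVal_eq (l : List Bool) : bitsVal l = (l.headD false).toNat + 2 * bitsVal l.tail := by
  cases l <;> rfl

theorem bitsVal_append (l l' : List Bool) :
    bitsVal (l ++ l') = bitsVal l + 2 ^ l.length * bitsVal l' := by
  induction l with
  | nil => simp [bitsVal]
  | cons b l ih => simp only [List.cons_append, bitsVal, ih, List.length_cons]; ring

theorem bitsVal_encodeNat (n : ℕ) : bitsVal (encodeNat n) = n := by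
  have h : ∀ p : PosNum, bitsVal (encodePosNum p) = p := by
    intro p
    induction p with
    | one => rfl
    | bit1 p ih => simp [encodePosNum, bitsVal, ih]; omega
    | bit0 p ih => simp [encodePosNum, bitsVal, ih]; omega
  have h' : ∀ m : Num, bitsVal (encodeNum m) = m := by
    rintro (_ | p)
    · rfl
    · exact h p
  simpa [encodeNat] using h' n

/-- One step of the addition of binary numbers: the state consists of the carry, the remaining
digits of the summands, and the digits computed so far. -/
def addStep (s : Bool × (List Bool × (List Bool × List Bool))) :
    Bool × (List Bool × (List Bool × List Bool)) :=
  let b := s.2.1.headD false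
  let c := s.2.2.1.headD false
  ((b && c) || (s.1 && (b ^^ c)), (s.2.1.tail, (s.2.2.1.tail, (s.1 ^^ (b ^^ c)) :: s.2.2.2)))

/-- Addition of binary numbers. -/
def bitsAdd (l l' : List Bool) : List Bool :=
  -- The list `l ++ l'` is only a clock, long enough to exhaust both summands.
  let s := (l ++ l').foldl (fun s _ => addStep s) (false, (l, (l', [])))
  (s.1 :: s.2.2.2).reverse

theorem addStep_iterate (n : ℕ) (s : Bool × (List Bool × (List Bool × List Bool))) :
    (addStep^[n] s).2.1 = s.2.1.drop n ∧ (addStep^[n] s).2.2.1 = s.2.2.1.drop n ∧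
      (addStep^[n] s).2.2.2.length = s.2.2.2.length + n := by
  induction n with
  | zero => simp
  | succ n ih =>
    rw [Function.iterate_succ_apply']
    obtain ⟨h₁, h₂, h₃⟩ := ih
    simp only [addStep, h₁, h₂, h₃, List.tail_drop, List.length_cons]
    exact ⟨trivial, trivial, rfl⟩

/-- A full adder preserves this quantity: the digits written so far, plus the carry and the unread
parts at their place value. It starts as the sum of the summands and ends as the value of the
result. -/
theorem bitsVal_addStep (s : Bool × (List Bool × (List Bool × List Bool))) :
    bitsVal (addStep s).2.2.2.reverse + 2 ^ (addStep s).2.2.2.length *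
        ((addStep s).1.toNat + bitsVal (addStep s).2.1 + bitsVal (addStep s).2.2.1) =
      bitsVal s.2.2.2.reverse + 2 ^ s.2.2.2.length *
        (s.1.toNat + bitsVal s.2.1 + bitsVal s.2.2.1) := by
  obtain ⟨c, a, b, r⟩ := s
  rw [bitsVal_eq a, bitsVal_eq b]
  simp only [addStep, List.reverse_cons, List.length_cons, bitsVal_append, List.length_reverse,
    pow_succ, mul_assoc, add_assoc, ← mul_add, bitsVal]
  congr 2
  generalize a.headD false = x, b.headD false = y
  cases c <;> cases x <;> cases y <;> simp <;> omega

theorem bitsVal_bitsAdd (l l' : List Bool) : bitsVal (bitsAdd l l') = bitsVal l + bitsVal l' := by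
  have h : ∀ n s, bitsVal (addStep^[n] s).2.2.2.reverse + 2 ^ (addStep^[n] s).2.2.2.length *
      ((addStep^[n] s).1.toNat + bitsVal (addStep^[n] s).2.1 + bitsVal (addStep^[n] s).2.2.1) =
        bitsVal s.2.2.2.reverse + 2 ^ s.2.2.2.length *
          (s.1.toNat + bitsVal s.2.1 + bitsVal s.2.2.1) := by
    intro n s
    induction n with
    | zero => rfl
    | succ n ih => rw [Function.iterate_succ_apply', bitsVal_addStep, ih]
  have h₁ := h (l ++ l').length (false, (l, (l', [])))
  obtain ⟨h₂, h₃, -⟩ := addStep_iterate (l ++ l').length (false, (l, (l', [])))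
  rw [h₂, h₃, List.drop_of_length_le (by simp), List.drop_of_length_le (by simp)] at h₁
  simp only [bitsAdd, List.foldl_const, List.reverse_cons, bitsVal_append, List.length_reverse]
  simpa [bitsVal] using h₁

/-- Leading zeros are never trimmed, but lengths merely add up, so summing a list of weights stays
polynomial. -/
theorem length_bitsAdd (l l' : List Bool) :
    (bitsAdd l l').length = l.length + l'.length + 1 := by
  have h := (addStep_iterate (l ++ l').length (false, (l, (l', [])))).2.2
  simp only [bitsAdd, List.foldl_const, List.length_reverse, List.length_cons]
  rw [h]
  simp

/-- Comparison of binary numbers: the state consists of the result of the comparison of the digits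
read so far, and of the remaining digits. -/
def leStep (s : Bool × (List Bool × List Bool)) : Bool × (List Bool × List Bool) :=
  let b := s.2.1.headD false
  let c := s.2.2.headD false
  (if b ^^ c then c else s.1, (s.2.1.tail, s.2.2.tail))

/-- Comparison of binary numbers. -/
def bitsLE (l l' : List Bool) : Bool :=
  ((l ++ l').foldl (fun s _ => leStep s) (true, (l, l'))).1

theorem leStep_iterate (n : ℕ) (s : Bool × (List Bool × List Bool)) :
    (leStep^[n] s).2.1 = s.2.1.drop n ∧ (leStep^[n] s).2.2 = s.2.2.drop n := by
  induction n with
  | zero => simp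
  | succ n ih =>
    rw [Function.iterate_succ_apply']
    simp only [leStep, ih.1, ih.2, List.tail_drop]
    exact ⟨trivial, trivial⟩

/-- Higher digits come later and override lower ones: the unread parts decide, and the recorded
result only breaks ties. -/
theorem leStep_iff (s : Bool × (List Bool × List Bool)) :
    (bitsVal (leStep s).2.1 < bitsVal (leStep s).2.2 ∨
        bitsVal (leStep s).2.1 = bitsVal (leStep s).2.2 ∧ (leStep s).1 = true) ↔
      (bitsVal s.2.1 < bitsVal s.2.2 ∨ bitsVal s.2.1 = bitsVal s.2.2 ∧ s.1 = true) := by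
  obtain ⟨c, a, b⟩ := s
  rw [bitsVal_eq a, bitsVal_eq b]
  simp only [leStep]
  generalize a.headD false = x, b.headD false = y
  cases c <;> cases x <;> cases y <;> simp <;> omega

theorem bitsLE_iff (l l' : List Bool) : bitsLE l l' = true ↔ bitsVal l ≤ bitsVal l' := by
  have h : ∀ n s, (bitsVal (leStep^[n] s).2.1 < bitsVal (leStep^[n] s).2.2 ∨
        bitsVal (leStep^[n] s).2.1 = bitsVal (leStep^[n] s).2.2 ∧ (leStep^[n] s).1 = true) ↔
      (bitsVal s.2.1 < bitsVal s.2.2 ∨ bitsVal s.2.1 = bitsVal s.2.2 ∧ s.1 = true) := by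
    intro n s
    induction n with
    | zero => rfl
    | succ n ih => rw [Function.iterate_succ_apply', leStep_iff, ih]
  have h₁ := h (l ++ l').length (true, (l, l'))
  obtain ⟨h₂, h₃⟩ := leStep_iterate (l ++ l').length (true, (l, l'))
  rw [h₂, h₃, List.drop_of_length_le (by simp), List.drop_of_length_le (by simp)] at h₁
  rw [bitsLE, List.foldl_const, le_iff_lt_or_eq]
  simpa [bitsVal] using h₁

namespace PT

variable {α : Type} [Enc α]

theorem size_bool_le (b : Bool) : size b ≤ 3 := by cases b <;> decide

theorem size_bits_le (l : List Bool) : size l ≤ 4 * l.length + 1 := by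
  rw [mul_comm]
  exact size_list_le le_rfl fun b _ => size_bool_le b

theorem addStep' : PT addStep := by
  unfold addStep
  fun_prop

theorem leStep' : PT leStep := by
  unfold leStep
  fun_prop

@[fun_prop]
theorem bitsAdd {f g : α → List Bool} (hf : PT f) (hg : PT g) :
    PT fun a => bitsAdd (f a) (g a) := by
  have hs := hf.polyBounded_size.add hg.polyBounded_size
  have key : PT fun a => (f a ++ g a).foldl (fun s _ => addStep s) (false, (f a, (g a, []))) := by
    refine foldl (h := fun _ s _ => addStep s) (hf.append hg) (by fun_prop)
      (addStep'.comp (by fun_prop)) (u := fun a => 5 * (size (f a) + size (g a)) + 10)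
      (((PolyBounded.const 5).mul hs).add (.const 10)) ?_
    intro a l₁ l₂ e
    rw [List.foldl_const]
    obtain ⟨h₁, h₂, h₃⟩ := addStep_iterate l₁.length (false, (f a, (g a, [])))
    have h₄ := size_bits_le (addStep^[l₁.length] (false, (f a, (g a, [])))).2.2.2
    generalize addStep^[l₁.length] (false, (f a, (g a, []))) = s at *
    obtain ⟨c, x, y, r⟩ := s
    dsimp only at h₁ h₂ h₃ h₄
    have h₅ := size_le_of_sublist (List.drop_sublist l₁.length (f a))
    have h₆ := size_le_of_sublist (List.drop_sublist l₁.length (g a))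
    have h₇ := size_bool_le c
    have h₈ := length_le_size (f a)
    have h₉ := length_le_size (g a)
    have h₁₀ := congrArg List.length e
    simp only [List.length_append, List.length_nil] at h₁₀ h₃
    simp only [size_prod, h₁, h₂]
    omega
  unfold _root_.bitsAdd
  fun_prop

@[fun_prop]
theorem bitsLE {f g : α → List Bool} (hf : PT f) (hg : PT g) :
    PT fun a => bitsLE (f a) (g a) := by
  have hs := hf.polyBounded_size.add hg.polyBounded_size
  have key : PT fun a => (f a ++ g a).foldl (fun s _ => leStep s) (true, (f a, g a)) := by
    refine foldl (h := fun _ s _ => leStep s) (hf.append hg) (by fun_prop)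
      (leStep'.comp (by fun_prop)) (u := fun a => (size (f a) + size (g a)) + 5)
      (hs.add (.const 5)) ?_
    intro a l₁ l₂ e
    rw [List.foldl_const]
    obtain ⟨h₁, h₂⟩ := leStep_iterate l₁.length (true, (f a, g a))
    generalize leStep^[l₁.length] (true, (f a, g a)) = s at *
    obtain ⟨c, x, y⟩ := s
    dsimp only at h₁ h₂
    have h₅ := size_le_of_sublist (List.drop_sublist l₁.length (f a))
    have h₆ := size_le_of_sublist (List.drop_sublist l₁.length (g a))
    have h₇ := size_bool_le c
    simp only [size_prod, h₁, h₂]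
    omega
  exact key.fst

end PT

/-! ### Listing the maximal independent sets -/

section misList

variable {α : Type} (adj : α → α → Bool)

/-- Add the vertex `v` to an independent set if possible. -/
def extendIndep (v : α) (S : List α) : List α := if S.all fun w => !adj v w then v :: S else S

/-- A list of independent sets of the graph induced by `H`. It contains all maximal ones if this
graph has no induced matching of size `j`. -/
def misList : ℕ → List α → List (List α)
  -- Nothing is required here, since the empty matching has size `0`.
  | 0, _ => []
  -- The first component of the state is the part of `H` already treated, which is what the
  -- recursive calls at `v` are restricted to.
  | j + 1, H => (H.foldr (fun v s => (v :: s.1, s.2.map (extendIndep adj v) ++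
      (s.1.filter (adj v)).flatMap fun u =>
        (misList j (s.1.filter fun w => !adj v w && !adj u w)).map (v :: ·))) ([], [[]])).2

theorem misList_foldr_fst (j : ℕ) (H : List α) :
    (H.foldr (fun v s => (v :: s.1, s.2.map (extendIndep adj v) ++
      (s.1.filter (adj v)).flatMap fun u =>
        (misList adj j (s.1.filter fun w => !adj v w && !adj u w)).map (v :: ·)))
      (([], [[]]) : List α × List (List α))).1 = H := by
  induction H with
  | nil => rfl
  | cons v T ih => rw [List.foldr_cons, ih]

theorem misList_foldr (j : ℕ) (H : List α) :
    (H.foldr (fun v s => (v :: s.1, s.2.map (extendIndep adj v) ++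
      (s.1.filter (adj v)).flatMap fun u =>
        (misList adj j (s.1.filter fun w => !adj v w && !adj u w)).map (v :: ·)))
      (([], [[]]) : List α × List (List α))) = (H, misList adj (j + 1) H) :=
  Prod.ext (misList_foldr_fst adj j H) (by rw [misList])

theorem misList_nil (j : ℕ) : misList adj (j + 1) [] = [[]] := by rw [misList, List.foldr_nil]

theorem misList_cons (j : ℕ) (v : α) (T : List α) :
    misList adj (j + 1) (v :: T) = (misList adj (j + 1) T).map (extendIndep adj v) ++
      (T.filter (adj v)).flatMap fun u =>
        (misList adj j (T.filter fun w => !adj v w && !adj u w)).map (v :: ·) := by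
  rw [misList, List.foldr_cons, misList_foldr_fst, misList]

theorem sublist_of_mem_misList (j : ℕ) : ∀ {H S : List α}, S ∈ misList adj j H → S.Sublist H := by
  induction j with
  | zero => intro H S h; simp [misList] at h
  | succ j ihj =>
    intro H
    induction H with
    | nil => intro S h; simp_all [misList_nil]
    | cons v T ih =>
      intro S h
      rw [misList_cons, List.mem_append, List.mem_map, List.mem_flatMap] at h
      rcases h with ⟨S', hS', rfl⟩ | ⟨u, -, h⟩
      · unfold extendIndep
        split_ifs
        · exact (ih hS').cons_cons v
        · exact (ih hS').cons v
      · obtain ⟨S', hS', rfl⟩ := List.mem_map.1 h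
        exact ((ihj hS').trans List.filter_sublist).cons_cons v

/-- Independence needs no hypothesis on matchings; only completeness of the list does. Listed sets
that are not maximal are harmless. -/
theorem pairwise_of_mem_misList (j : ℕ) : ∀ {H S : List α}, S ∈ misList adj j H →
    S.Pairwise fun v w => adj v w = false := by
  induction j with
  | zero => intro H S h; simp [misList] at h
  | succ j ihj =>
    intro H
    induction H with
    | nil => intro S h; simp_all [misList_nil]
    | cons v T ih =>
      intro S h
      rw [misList_cons, List.mem_append, List.mem_map, List.mem_flatMap] at h
      rcases h with ⟨S', hS', rfl⟩ | ⟨u, -, h⟩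
      · unfold extendIndep
        split_ifs with hv
        · exact List.pairwise_cons.2 ⟨by simpa using hv, ih hS'⟩
        · exact ih hS'
      · obtain ⟨S', hS', rfl⟩ := List.mem_map.1 h
        refine List.pairwise_cons.2 ⟨fun w hw => ?_, ihj hS'⟩
        have := List.of_mem_filter ((sublist_of_mem_misList adj j hS').subset hw)
        simp_all

/-- A polynomial bounding the length of `misList adj j`. -/
noncomputable def misBound : ℕ → Polynomial ℕ
  | 0 => 0
  | j + 1 => 1 + Polynomial.X * (Polynomial.X * misBound j)

theorem length_misList_le (j : ℕ) :
    ∀ H : List α, (misList adj j H).length ≤ (misBound j).eval H.length := by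
  induction j with
  | zero => intro H; simp [misList]
  | succ j ihj =>
    intro H
    -- Keeping `H.length` fixed makes the contribution of each vertex uniform, so the induction on
    -- `T` only adds up equal terms.
    have key : ∀ T : List α, T.length ≤ H.length → (misList adj (j + 1) T).length ≤
        1 + T.length * (H.length * (misBound j).eval H.length) := by
      intro T
      induction T with
      | nil => intro _; simp [misList_nil]
      | cons v T ih =>
        intro hT
        rw [List.length_cons] at hT
        have h₁ := ih (by omega)
        have h₂ : ((T.filter (adj v)).flatMap fun u =>
            (misList adj j (T.filter fun w => !adj v w && !adj u w)).map (v :: ·)).length ≤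
              H.length * (misBound j).eval H.length := by
          rw [List.length_flatMap]
          refine (List.sum_le_card_nsmul _ ((misBound j).eval H.length) ?_).trans ?_
          · intro n hn
            obtain ⟨u, -, rfl⟩ := List.mem_map.1 hn
            rw [List.length_map]
            exact (ihj _).trans (PolyBounded.eval_mono _
              ((List.length_filter_le _ _).trans (by omega)))
          · rw [List.length_map, smul_eq_mul]
            gcongr
            exact (List.length_filter_le _ _).trans (by omega)
        rw [misList_cons, List.length_append, List.length_map, List.length_cons, Nat.succ_mul]
        omega
    simpa [misBound] using key H le_rfl

end misList

/-! ### The algorithm -/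

/-- A vertex is given by its number, its row of the adjacency matrix and its weight. -/
abbrev VertexData := ℕ × (List Bool × List Bool)

/-- The adjacency relation, read off the rows of the adjacency matrix. -/
def rowAdj (x y : VertexData) : Bool := (x.2.1.drop y.1).headD false

/-- Number the elements of a list (in decreasing order). -/
def number {β : Type} (l : List β) : List (ℕ × β) := l.foldl (fun acc b => (acc.length, b) :: acc) []

/-- The total weight of a set of vertices. -/
def listWeight (S : List VertexData) : List Bool := S.foldr (fun v s => bitsAdd v.2.2 s) []

/-- A set of maximum weight in a family of sets of vertices. -/
def heaviest (F : List (List VertexData)) : List VertexData :=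
  F.foldr (fun S T => if bitsLE (listWeight T) (listWeight S) then S else T) []

/-- A step of the parser, which reads the tokens from the last to the first. The state consists of
the digits of the current number, of the weight of the current vertex, and of the rows and weights
of the vertices read so far. -/
def parseStep (s : List Bool × (List Bool × List (List Bool × List Bool)))
    (x : Bool × (Bool × Bool)) : List Bool × (List Bool × List (List Bool × List Bool)) :=
  if x.1 then (x.2.1 :: s.1, s.2)
  else if x.2.1 then (if x.2.2 then ([], ([], (s.1, s.2.1) :: s.2.2)) else ([], s.2))
  else ([], (s.1, s.2.2))

/-- The rows of the adjacency matrix and the weights, read off the reversed list of tokens. -/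
def parse (l : List (Bool × (Bool × Bool))) : List (List Bool × List Bool) :=
  (l.foldl parseStep ([], ([], []))).2.2

/-- The algorithm for Weighted Independent Set on graphs with no induced matching of size `j`. The
output is the characteristic vector in reverse order. -/
def solve (j : ℕ) (l : List (Bool × (Bool × Bool))) : List Bool :=
  let V := number (parse l)
  let S := heaviest (misList rowAdj j V)
  V.map fun v => S.any fun w => w.1 == v.1

theorem length_listWeight_le (l : List VertexData) : (listWeight l).length ≤ size l := by
  induction l with
  | nil => simp [listWeight]
  | cons v l ih =>
    have h₁ := length_le_size v.2.2
    have h₂ : size v = 1 + size v.1 + (1 + size v.2.1 + size v.2.2) := by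
      rw [← size_prod, ← size_prod]
    have h₃ := length_bitsAdd v.2.2 (listWeight l)
    have h₄ : listWeight (v :: l) = bitsAdd v.2.2 (listWeight l) := rfl
    rw [size_cons, h₄, h₃]
    omega

/-! ### Polynomial running time of the algorithm -/

namespace PT

variable {α β γ : Type} [Enc α] [Enc β] [Enc γ]

theorem extendIndep {adj : α → α → Bool} (hadj : PT fun x : α × α => adj x.1 x.2) :
    PT fun x : α × List α => extendIndep adj x.1 x.2 := by
  have h : PT fun x : α × List α => x.2.all fun w => !adj x.1 w :=
    all (h := fun x w => !adj x.1 w) snd' (not (hadj.comp (f := fun y : (α × List α) × α => (y.1.1, y.2)) (by fun_prop)))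
  unfold _root_.extendIndep
  fun_prop

/-- As `j` is fixed, the recursion on `j` unfolds into finitely many nested programs. The
intermediate results of the fold are the lists for suffixes of `H`: polynomially many sets, each a
sublist of `H`. -/
theorem misList {adj : α → α → Bool} (hadj : PT fun x : α × α => adj x.1 x.2) (j : ℕ) :
    PT (misList adj j) := by
  induction j with
  | zero => exact const []
  | succ j ih =>
    have hadj' : ∀ {δ : Type} [Enc δ] {f g : δ → α}, PT f → PT g → PT fun d => adj (f d) (g d) :=
      fun hf hg => hadj.comp (hf.prodMk hg)
    have hmap : PT fun x : List α × (α × (List α × List (List α))) =>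
        x.2.2.2.map (_root_.extendIndep adj x.2.1) :=
      map (by fun_prop) (h := fun (x : List α × (α × (List α × List (List α)))) S => _root_.extendIndep adj x.2.1 S)
        ((extendIndep hadj).comp (f := fun y : (List α × (α × (List α × List (List α)))) × List α =>
          (y.1.2.1, y.2)) (by fun_prop))
    have hfilter : PT fun x : List α × (α × (List α × List (List α))) =>
        x.2.2.1.filter (adj x.2.1) :=
      filter (by fun_prop) (h := fun (x : List α × (α × (List α × List (List α)))) u => adj x.2.1 u) (hadj' (by fun_prop) (by fun_prop))
    have hrec : PT fun y : (List α × (α × (List α × List (List α)))) × α =>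
        _root_.misList adj j (y.1.2.2.1.filter fun w => !adj y.1.2.1 w && !adj y.2 w) :=
      ih.comp (filter (by fun_prop) (h := fun (y : (List α × (α × (List α × List (List α)))) × α) w =>
        !adj y.1.2.1 w && !adj y.2 w)
        (and (not (hadj' (by fun_prop) (by fun_prop))) (not (hadj' (by fun_prop) (by fun_prop)))))
    have hflat : PT fun x : List α × (α × (List α × List (List α))) =>
        (x.2.2.1.filter (adj x.2.1)).flatMap fun u => (_root_.misList adj j
          (x.2.2.1.filter fun w => !adj x.2.1 w && !adj u w)).map (x.2.1 :: ·) :=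
      flatMap hfilter (h := fun x u => (_root_.misList adj j
          (x.2.2.1.filter fun w => !adj x.2.1 w && !adj u w)).map (x.2.1 :: ·))
        (map hrec (h := fun y S => y.1.2.1 :: S) (by fun_prop))
    refine (snd (foldr (h := fun (_ : List α) v s => (v :: s.1,
      s.2.map (_root_.extendIndep adj v) ++ (s.1.filter (adj v)).flatMap fun u =>
        (_root_.misList adj j (s.1.filter fun w => !adj v w && !adj u w)).map (v :: ·)))
      id (const ([], [[]])) ?_ (u := fun H => 1 + size H +
        ((misBound (j + 1)).eval (size H) * (size H + 1) + 1)) ?_ ?_)).of_eq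
          fun H => by rw [_root_.misList]
    · have := hmap.append hflat
      fun_prop
    · exact ((PolyBounded.const 1).add .size).add
        (((PolyBounded.size.eval _).mul (.add .size (.const 1))).add (.const 1))
    · intro H l₁ l₂ e
      refine (congrArg size (misList_foldr adj j l₂)).le.trans ?_
      rw [size_prod]
      have hl : l₂.Sublist H := e ▸ List.sublist_append_right l₁ l₂
      have h₃ := size_le_of_sublist hl
      have h₄ := size_list_le (length_misList_le adj (j + 1) l₂) fun S hS =>
        (size_le_of_sublist (sublist_of_mem_misList adj (j + 1) hS)).trans h₃
      have h₅ := PolyBounded.eval_mono (misBound (j + 1))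
        ((length_le_size l₂).trans h₃)
      have h₆ := Nat.mul_le_mul_right (size H + 1) h₅
      dsimp only at h₆
      omega

theorem rowAdj : PT fun x : VertexData × VertexData => rowAdj x.1 x.2 := by
  unfold _root_.rowAdj
  fun_prop

theorem listWeight : PT listWeight := by
  have hstep : PT fun x : List VertexData × (VertexData × List Bool) =>
      _root_.bitsAdd x.2.1.2.2 x.2.2 := by fun_prop
  have hsize : ∀ a l₁ l₂ : List VertexData, a = l₁ ++ l₂ →
      size (l₂.foldr (fun v s => _root_.bitsAdd v.2.2 s) []) ≤ 4 * size a + 1 := by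
    intro a l₁ l₂ e
    have hl : l₂.Sublist a := e ▸ List.sublist_append_right l₁ l₂
    have h₁ := size_bits_le (_root_.listWeight l₂)
    have h₂ := length_listWeight_le l₂
    have h₃ := size_le_of_sublist hl
    have h₄ : size (_root_.listWeight l₂) ≤ 4 * size a + 1 := by omega
    exact h₄
  exact (foldr (h := fun (_ : List VertexData) v s => _root_.bitsAdd v.2.2 s) id (const []) hstep
    (u := fun l => 4 * size l + 1) (((PolyBounded.const 4).mul .size).add (.const 1)) hsize).of_eq
      fun _ => rfl

theorem heaviest : PT heaviest := by
  have h : PT fun x : List (List VertexData) × (List VertexData × List VertexData) =>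
      _root_.bitsLE (_root_.listWeight x.2.2) (_root_.listWeight x.2.1) :=
    bitsLE (listWeight.comp (by fun_prop)) (listWeight.comp (by fun_prop))
  refine foldr (h := fun (_ : List (List VertexData)) S T =>
    if _root_.bitsLE (_root_.listWeight T) (_root_.listWeight S) then S else T) id (const [])
    (by fun_prop) (u := fun F => size F) .size ?_
  intro F l₁ l₂ e
  have hmem : ∀ S ∈ l₂, S ∈ F := by simp [show F = _ from e]; tauto
  clear e
  induction l₂ with
  | nil => rw [List.foldr_nil, size_nil]; exact size_pos F
  | cons S l ih =>
    rw [List.foldr_cons]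
    split_ifs
    · exact size_le_of_mem (hmem S List.mem_cons_self)
    · exact ih fun T hT => hmem T (List.mem_cons_of_mem _ hT)

theorem parse : PT parse := by
  have hstep : PT fun x : (List Bool × (List Bool × List (List Bool × List Bool))) ×
      (Bool × (Bool × Bool)) => parseStep x.1 x.2 := by
    unfold parseStep
    fun_prop
  refine (foldl (h := fun (_ : List (Bool × (Bool × Bool))) s x => parseStep s x) id
    (const ([], ([], []))) (hstep.comp (f := fun x : List (Bool × (Bool × Bool)) ×
      ((Bool × (Bool × Bool)) × (List Bool × (List Bool × List (List Bool × List Bool)))) =>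
        (x.2.2, x.2.1)) (by fun_prop)) (u := fun l => 5 + 4 * size l)
    ((PolyBounded.const 5).add ((PolyBounded.const 4).mul .size)) ?_).snd.snd
  -- A token adds at most 4 to the size of the state: a digit costs a list node and a truth value, a
  -- finished vertex a few tree nodes.
  have key : ∀ (l : List (Bool × (Bool × Bool))) s,
      size (l.foldl parseStep s) ≤ size s + 4 * l.length := by
    intro l
    induction l with
    | nil => intro s; simp
    | cons x l ih =>
      intro s
      refine (ih _).trans ?_
      obtain ⟨b, w, L⟩ := s
      have h₁ := size_pos b
      have h₂ := size_pos w
      have h₃ := size_bool_le x.2.1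
      unfold parseStep
      split_ifs <;> simp only [size_prod, size_cons, size_nil, List.length_cons] <;> omega
  intro l l₁ l₂ e
  refine (key l₁ _).trans ?_
  have := length_le_size l
  have := congrArg List.length e
  rw [List.length_append] at this
  simp only [size_prod, size_nil]
  omega

theorem size_nat (n : ℕ) : size n = 2 * n + 1 := by
  change size (List.replicate n ()) = _
  induction n with
  | zero => rfl
  | succ n ih =>
    rw [List.replicate_succ, size_cons, ih]
    change 1 + 1 + _ = _
    omega

end PT

theorem number_append_singleton {β : Type} (l : List β) (b : β) :
    number (l ++ [b]) = ((number l).length, b) :: number l := by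
  simp [number]

theorem number_eq {β : Type} (l : List β) : number l = (l.mapIdx fun i b => (i, b)).reverse := by
  induction l using List.reverseRecOn with
  | nil => rfl
  | append_singleton l b ih => rw [number_append_singleton, ih]; simp

namespace PT

variable {α β γ : Type} [Enc α] [Enc β] [Enc γ]

theorem number : PT (number : List β → List (ℕ × β)) := by
  refine foldl (h := fun (_ : List β) acc b => (acc.length, b) :: acc) id (const [])
    (by fun_prop) (u := fun l => size l * ((1 + (2 * size l + 1) + size l) + 1) + 1)
    ((PolyBounded.size.mul ((((PolyBounded.const 1).add
      (((PolyBounded.const 2).mul .size).add (.const 1))).add .size).add (.const 1))).add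
        (.const 1)) ?_
  intro l l₁ l₂ e
  change size (_root_.number l₁) ≤ _
  have h₁ := length_le_size l
  have h₂ : l₁.Sublist l := e ▸ List.sublist_append_left l₁ l₂
  have h₃ := h₂.length_le
  rw [number_eq]
  refine size_list_le (by simp; omega) fun x hx => ?_
  rw [List.mem_reverse, List.mem_mapIdx] at hx
  obtain ⟨i, hi, rfl⟩ := hx
  have h₄ := size_le_of_mem (h₂.subset (List.getElem_mem hi))
  rw [size_prod, size_nat]
  omega

theorem solve (j : ℕ) : PT (solve j) := by
  have hV : PT fun l => _root_.number (_root_.parse l) := number.comp parse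
  have hS : PT fun l => _root_.heaviest (_root_.misList _root_.rowAdj j
      (_root_.number (_root_.parse l))) := heaviest.comp ((misList rowAdj j).comp hV)
  exact map hV (h := fun l v => (_root_.heaviest (_root_.misList _root_.rowAdj j
    (_root_.number (_root_.parse l)))).any fun w => w.1 == v.1)
    (any (hS.comp fst') (h := fun (x : List (Bool × (Bool × Bool)) × VertexData) w => w.1 == x.2.1)
      (by fun_prop))

end PT

/-! ### Reading the input and writing the output -/

/-- Input symbols as triples of truth values. -/
def token : Γ' → Bool × (Bool × Bool)
  | .bit b => (true, (b, false))
  | .bra => (false, (true, true))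
  | .ket => (false, (true, false))
  | .comma => (false, (false, false))
  | .blank => (false, (false, true))

namespace StackProg

theorem exec_loop₀_nil {p : Option Bool → StackProg Sym} {s r q : List Bool} {x : List Γ'}
    {y : List Bool} :
    Exec (loop (Γ := Sym) (val 0) (fun b => b == some true) p) (st ![false :: s, r, q] [] [] x y) 1
      (st ![s, r, q] [] [] x y) := by
  have := Exec.loop_done (Γ := Sym) (k := val 0) (c := fun b => b == some true) (f := p)
    (S := st ![false :: s, r, q] [] [] x y) rfl
  rw [update_val] at this
  simpa [update₀, st] using this

theorem exec_loop₀_cons {p : Option Bool → StackProg Sym} {s r q : List Bool} {x : List Γ'}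
    {y : List Bool} {m n : ℕ} {S S' : ∀ k : Stk, List k.Sym}
    (h : Exec (p (some true)) (st ![s, r, q] [] [] x y) m S)
    (h' : Exec (loop (Γ := Sym) (val 0) (fun b => b == some true) p) S n S') :
    Exec (loop (Γ := Sym) (val 0) (fun b => b == some true) p) (st ![true :: s, r, q] [] [] x y)
      (m + n + 1) S' := by
  refine Exec.loop_step (k := val 0) rfl ?_ h'
  rw [update_val]
  simpa [update₀, st] using h

/-- Replace the input by the code of the reversed list of its tokens. -/
def readInput : StackProg Sym :=
  seq (push (val 0) false) (loop inp Option.isSome fun g =>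
    g.elim skip fun g => pushList (true :: enc (token g)))

theorem exec_readInput (w : List Γ') :
    Exec readInput (st ![[], [], []] [] [] w []) (15 * w.length + 2)
      (st ![enc (w.map token).reverse ++ [], [], []] [] [] [] []) := by
  have key : ∀ (w : List Γ') (s : List (Bool × (Bool × Bool))),
      Exec (loop (Γ := Sym) inp Option.isSome fun g =>
        g.elim skip fun g => pushList (true :: enc (token g)))
        (st ![enc s, [], []] [] [] w []) (15 * w.length + 1)
        (st ![enc ((w.map token).reverse ++ s), [], []] [] [] [] []) := by
    intro w
    induction w with
    | nil =>
      intro s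
      have := Exec.loop_done (Γ := Sym) (k := inp) (c := Option.isSome)
        (f := fun g => g.elim skip fun g => pushList (true :: enc (token g)))
        (S := st ![enc s, [], []] [] [] [] []) rfl
      rwa [update_inp] at this
    | cons g w ih =>
      intro s
      have h₁ := ih (token g :: s)
      have h₂ : (enc (token g)).length ≤ 12 := by
        cases g with
        | bit b => cases b <;> decide
        | _ => decide
      rw [List.map_cons, List.reverse_cons, List.append_assoc]
      refine Exec.weaken (Exec.loop_step (k := inp) (t := (enc (token g)).length + 2) rfl ?_ h₁) ?_
      · rw [update_inp]
        exact exec_pushList (s := enc s) (true :: enc (token g))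
      · rw [List.length_cons]; omega
  have h := (exec_push₀ (s := []) (r := []) (q := []) (x := w) (y := []) false).seq (key w [])
  rw [List.append_nil] at h ⊢
  exact h.weaken (by omega)

/-- Move a list of truth values to the output stack, reversing it. -/
def writeOutput : StackProg Sym :=
  loop (val 0) (fun b => b == some true) fun _ => case (val 0) fun b =>
    -- The code of `true` has two leaves after its first symbol; they are popped unread.
    if b = some true then seq (push out true) (seq (case (val 0) fun _ => skip)
      (case (val 0) fun _ => skip))
    else push out false

theorem exec_writeOutput (l y : List Bool) :
    Exec writeOutput (st ![enc l ++ [], [], []] [] [] [] y) (8 * l.length + 1)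
      (st ![[], [], []] [] [] [] (l.reverse ++ y)) := by
  induction l generalizing y with
  | nil => exact exec_loop₀_nil
  | cons b l ih =>
    have h := ih (b :: y)
    rw [List.reverse_cons, List.append_assoc]
    rw [enc_cons, List.cons_append, List.append_assoc]
    refine (exec_loop₀_cons (m := 6) ?_ h).weaken (by rw [List.length_cons]; omega)
    cases b
    · refine Exec.weaken (t := 1 + 1) (exec_case₀ ?_) (by omega)
      rw [if_neg (by simp)]
      exact exec_push_out false
    · refine Exec.weaken (t := (1 + ((1 + 1) + (1 + 1))) + 1) (exec_case₀ ?_) (by omega)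
      rw [if_pos rfl]
      refine (exec_push_out true).seq (Exec.seq (S' := st ![false :: (enc l ++ []), [], []] [] [] []
        (true :: y)) (exec_case₀ ?_) (exec_case₀ ?_))
      exacts [Exec.skip _, Exec.skip _]

end StackProg

/-- A polynomial-time function of the list of input tokens is computed in polynomial time by a
Turing machine, up to the reversal of input and output. -/
theorem PT.nonempty_computableInPolyTime {f : List (Bool × (Bool × Bool)) → List Bool} (hf : PT f)
    {α : Type} (ea : α → List Γ') :
    Nonempty (Turing.TM2ComputableInPolyTime ea (fun s : List Bool => s)
      fun a => (f ((ea a).map token).reverse).reverse) := by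
  obtain ⟨q, hq⟩ := hf.polyBounded_size
  obtain ⟨P, t, ⟨p, hp⟩, hP⟩ := hf
  let S : Polynomial ℕ := 14 * Polynomial.X + 1
  have hS : ∀ w : List Γ', size (w.map token).reverse ≤ S.eval w.length := by
    intro w
    refine (size_list_le (n := w.length) (s := 13) (by simp) ?_).trans (by simp [S]; omega)
    intro x hx
    obtain ⟨a, b, c⟩ := x
    have h₁ := size_bool_le a
    have h₂ := size_bool_le b
    have h₃ := size_bool_le c
    simp only [size_prod]
    omega
  let T : Polynomial ℕ := (15 * Polynomial.X + 2) + (p.comp S + (8 * q.comp S + 1))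
  have hT : ∀ w : List Γ', Exec (seq readInput (seq P writeOutput)) (single inp w) (T.eval w.length)
      (single out (f (w.map token).reverse).reverse) := by
    intro w
    have e₁ : single (Γ := Sym) inp w = st ![[], [], []] [] [] w [] := by
      funext k
      cases k with
      | val i => fin_cases i <;> rfl
      | _ => rfl
    have e₂ : single (Γ := Sym) out (f (w.map token).reverse).reverse =
        st ![[], [], []] [] [] [] ((f (w.map token).reverse).reverse ++ []) := by
      rw [List.append_nil]
      funext k
      cases k with
      | val i => fin_cases i <;> rfl
      | _ => rfl
    rw [e₁, e₂]
    refine ((exec_readInput w).seq ((hP _ [] [] [] [] []).seq (exec_writeOutput _ []))).weaken ?_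
    have h₁ := (hp _).trans (PolyBounded.eval_mono p (hS w))
    have h₂ := ((length_le_size _).trans (hq _)).trans (PolyBounded.eval_mono q (hS w))
    simp only [T, Polynomial.eval_add, Polynomial.eval_mul, Polynomial.eval_comp,
      Polynomial.eval_X, Polynomial.eval_one, Polynomial.eval_ofNat]
    dsimp only at h₁ h₂
    omega
  refine ⟨⟨⟨machine (seq readInput (seq P writeOutput)) inp out, Equiv.refl _, Equiv.refl _⟩,
    T + 1, fun a => ?_⟩⟩
  have h := (hT (ea a)).outputsInTime.some
  have h₁ : (T + 1).eval (ea a).length = T.eval (ea a).length + 1 := by simp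
  rw [h₁]
  have e₁ : List.map (Equiv.refl Γ').invFun (ea a) = ea a := List.map_id _
  have e₂ : List.map (Equiv.refl Bool).invFun (f ((ea a).map token).reverse).reverse =
    (f ((ea a).map token).reverse).reverse := List.map_id _
  exact cast (by congr 1; exacts [e₁.symm, congrArg some e₂.symm]) h

/-! ### Correctness of the algorithm -/

section misList

variable {α : Type} (adj : α → α → Bool)

/-- The graph induced by `H` has an induced matching of size `j`. -/
def HasInducedMatching : ℕ → List α → Prop
  | 0, _ => True
  | j + 1, H => ∃ v ∈ H, ∃ u ∈ H, adj v u = true ∧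
      HasInducedMatching j (H.filter fun w => !adj v w && !adj u w)

theorem HasInducedMatching.mono (j : ℕ) : ∀ {H H' : List α}, H ⊆ H' →
    HasInducedMatching adj j H → HasInducedMatching adj j H' := by
  induction j with
  | zero => intros; trivial
  | succ j ih =>
    rintro H H' h ⟨v, hv, u, hu, huv, hM⟩
    refine ⟨v, h hv, u, h hu, huv, ih ?_ hM⟩
    intro w hw
    rw [List.mem_filter] at hw ⊢
    exact ⟨h hw.1, hw.2⟩

/-- `S` is a maximal independent set of the graph induced by `H`. -/
structure IsMaxIndep (H : List α) (S : Set α) : Prop where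
  subset : ∀ x ∈ S, x ∈ H
  indep : ∀ x ∈ S, ∀ y ∈ S, adj x y = false
  maximal : ∀ w ∈ H, w ∉ S → ∃ x ∈ S, adj w x = true

theorem exists_mem_misList (symm : ∀ x y, adj x y = adj y x) (j : ℕ) :
    ∀ {H : List α} {S : Set α}, H.Nodup → ¬ HasInducedMatching adj j H →
      IsMaxIndep adj H S → ∃ l ∈ misList adj j H, ∀ x, x ∈ l ↔ x ∈ S := by
  induction j with
  | zero => intro H S _ h; exact absurd trivial h
  | succ j ihj =>
    intro H
    induction H with
    | nil =>
      intro S _ _ hS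
      refine ⟨[], by simp [misList_nil], fun x => ?_⟩
      exact ⟨fun h => absurd h (by simp), hS.subset x⟩
    | cons v T ih =>
      intro S hnd hM hS
      obtain ⟨hvT, hT⟩ := List.nodup_cons.1 hnd
      have hMT : ¬ HasInducedMatching adj (j + 1) T :=
        fun h => hM (h.mono adj (j + 1) (List.subset_cons_self v T))
      have mem_left : ∀ l ∈ misList adj (j + 1) T,
          extendIndep adj v l ∈ misList adj (j + 1) (v :: T) := fun l hl => by
        rw [misList_cons]
        exact List.mem_append_left _ (List.mem_map_of_mem hl)
      by_cases hv : v ∈ S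
      · have hindep : ∀ x ∈ S \ {v}, ∀ y ∈ S \ {v}, adj x y = false :=
          fun x hx y hy => hS.indep x hx.1 y hy.1
        have hmemT : ∀ x ∈ S \ {v}, x ∈ T := fun x hx =>
          (List.mem_cons.1 (hS.subset x hx.1)).resolve_left hx.2
        -- If `S \ {v}` is maximal in `T`, it is already listed and accepts `v`; otherwise the
        -- recursive families are needed.
        by_cases hmax : ∀ w ∈ T, w ∉ S \ {v} → ∃ x ∈ S \ {v}, adj w x = true
        · obtain ⟨l, hl, hlS⟩ := ih hT hMT ⟨hmemT, hindep, hmax⟩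
          refine ⟨_, mem_left l hl, fun x => ?_⟩
          have hall : l.all (fun w => !adj v w) = true := by
            simp only [List.all_eq_true, Bool.not_eq_true']
            exact fun w hw => hS.indep v hv w ((hlS w).1 hw).1
          rw [extendIndep, if_pos hall, List.mem_cons, hlS]
          by_cases hx : x = v
          · simp [hx, hv]
          · simp [hx]
        · push Not at hmax
          obtain ⟨u, huT, huS, hu⟩ := hmax
          have huv : u ≠ v := fun h => hvT (h ▸ huT)
          have huS' : u ∉ S := fun h => huS ⟨h, huv⟩
          -- Since `u` has no neighbour in `S \ {v}`, the neighbour that maximality of `S` provides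
          -- must be `v`.
          obtain ⟨y, hyS, hy⟩ := hS.maximal u (List.mem_cons_of_mem _ huT) huS'
          have hyv : y = v := by
            by_contra h
            exact hu y ⟨hyS, h⟩ hy
          subst hyv
          have hvu : adj y u = true := by rw [symm]; exact hy
          -- A matching of size `j` among the common non-neighbours of `y` and `u` would extend by
          -- the edge `yu`. Maximality is inherited, because a vertex there is not adjacent to `y`
          -- and so has its neighbour in `S \ {y}`.
          obtain ⟨l, hl, hlS⟩ := @ihj (T.filter fun w => !adj y w && !adj u w) (S \ {y})
            (hT.filter _) (fun h => hM ⟨y, List.mem_cons_self, u, List.mem_cons_of_mem _ huT, hvu,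
              h.mono adj j fun w hw => by
                rw [List.mem_filter] at hw ⊢
                exact ⟨List.mem_cons_of_mem _ hw.1, hw.2⟩⟩) ⟨fun x hx => by
              rw [List.mem_filter]
              have h₁ := hS.indep y hv x hx.1
              have h₂ : adj u x = false := by simpa using hu x hx
              exact ⟨hmemT x hx, by simp [h₁, h₂]⟩, hindep, fun w hw hwS => by
              rw [List.mem_filter] at hw
              have hwy : w ≠ y := fun h => hvT (h ▸ hw.1)
              obtain ⟨x, hxS, hx⟩ := hS.maximal w (List.mem_cons_of_mem _ hw.1)
                fun h => hwS ⟨h, hwy⟩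
              refine ⟨x, ⟨hxS, fun h => ?_⟩, hx⟩
              rw [Set.mem_singleton_iff.1 h, symm] at hx
              simp [hx] at hw⟩
          refine ⟨y :: l, ?_, fun x => ?_⟩
          · rw [misList_cons]
            refine List.mem_append_right _ (List.mem_flatMap.2 ⟨u, ?_, List.mem_map_of_mem hl⟩)
            exact List.mem_filter.2 ⟨huT, hvu⟩
          · rw [List.mem_cons, hlS]
            by_cases hx : x = y
            · simp [hx, hv]
            · simp [hx]
      · have hmemT : ∀ x ∈ S, x ∈ T := fun x hx =>
          (List.mem_cons.1 (hS.subset x hx)).resolve_left fun h => hv (h ▸ hx)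
        obtain ⟨l, hl, hlS⟩ := ih hT hMT
          ⟨hmemT, hS.indep, fun w hw => hS.maximal w (List.mem_cons_of_mem _ hw)⟩
        refine ⟨_, mem_left l hl, fun x => ?_⟩
        -- A neighbour of `v` in `S` makes `extendIndep` leave the set unchanged.
        obtain ⟨y, hyS, hy⟩ := hS.maximal v List.mem_cons_self hv
        have hall : ¬ l.all (fun w => !adj v w) = true := by
          simp only [List.all_eq_true, Bool.not_eq_true', not_forall]
          exact ⟨y, (hlS y).2 hyS, by simp [hy]⟩
        rw [extendIndep, if_neg hall, hlS]

/-- The construction looks only at adjacency. This carries correctness from the vertices `Fin n` to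
the records that the algorithm handles. -/
theorem misList_map {β : Type} (adj' : β → β → Bool) (f : α → β)
    (hf : ∀ x y, adj' (f x) (f y) = adj x y) (j : ℕ) :
    ∀ H : List α, misList adj' j (H.map f) = (misList adj j H).map (List.map f) := by
  induction j with
  | zero => intro H; rfl
  | succ j ihj =>
    intro H
    induction H with
    | nil => simp [misList_nil]
    | cons v T ih =>
      have hext : ∀ S : List α, extendIndep adj' (f v) (S.map f) = (extendIndep adj v S).map f := by
        intro S
        simp only [extendIndep, List.all_map, Function.comp_def, hf]
        split_ifs <;> rfl
      rw [List.map_cons, misList_cons, misList_cons, ih]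
      simp only [List.map_append, List.map_map, List.map_flatMap, List.filter_map, List.flatMap_map,
        Function.comp_def, hf, hext, ihj, List.map_cons]

end misList

/-! ### Bounding induced matchings in well-indumatched graphs -/

section matching

variable {V : Type} [DecidableEq V] (G : SimpleGraph V) [DecidableRel G.Adj]

theorem HasInducedMatching.exists_isInducedMatching (j : ℕ) : ∀ {H : List V},
    HasInducedMatching (fun v w => decide (G.Adj v w)) j H →
      ∃ M : Finset (Sym2 V), G.IsInducedMatching M ∧ M.card = j ∧ ∀ e ∈ M, ∀ x ∈ e, x ∈ H := by
  induction j with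
  | zero => intro H _; exact ⟨∅, by simp [SimpleGraph.IsInducedMatching, SimpleGraph.IsEdgeMatching]⟩
  | succ j ih =>
    rintro H ⟨v, hv, u, hu, huv, hM⟩
    obtain ⟨M, ⟨⟨hM₁, hM₂⟩, hM₃⟩, hcard, hMH⟩ := ih hM
    have huv' : G.Adj v u := by simpa using huv
    -- The remaining edges live among the common non-neighbours of `v` and `u`. This also keeps them
    -- disjoint from `vu`, as each of `v` and `u` is a neighbour of the other.
    have hfar : ∀ f ∈ M, ∀ y ∈ f, ∀ x ∈ s(v, u), x ≠ y ∧ ¬ G.Adj x y := by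
      intro f hf y hy x hx
      have h := (List.mem_filter.1 (hMH f hf y hy)).2
      simp only [Bool.and_eq_true, Bool.not_eq_true', decide_eq_false_iff_not] at h
      rcases Sym2.mem_iff.1 hx with rfl | rfl
      · exact ⟨fun e => h.2 (e ▸ huv'.symm), h.1⟩
      · exact ⟨fun e => h.1 (e ▸ huv'), h.2⟩
    have hnot : s(v, u) ∉ M := fun h =>
      (hfar _ h v (Sym2.mem_mk_left v u) v (Sym2.mem_mk_left v u)).1 rfl
    refine ⟨insert s(v, u) M, ⟨⟨?_, ?_⟩, ?_⟩, by rw [Finset.card_insert_of_notMem hnot, hcard], ?_⟩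
    · rw [Finset.coe_insert, Set.insert_subset_iff]
      exact ⟨huv', hM₁⟩
    · intro e he f hf hef x hx y hy
      rcases Finset.mem_insert.1 he with rfl | he <;> rcases Finset.mem_insert.1 hf with rfl | hf
      · exact absurd rfl hef
      · exact (hfar f hf y hy x hx).1
      · exact (hfar e he x hx y hy).1.symm
      · exact hM₂ e he f hf hef x hx y hy
    · intro e he f hf hef x hx y hy
      rcases Finset.mem_insert.1 he with rfl | he <;> rcases Finset.mem_insert.1 hf with rfl | hf
      · exact absurd rfl hef
      · exact (hfar f hf y hy x hx).2
      · exact fun h => (hfar e he x hx y hy).2 h.symm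
      · exact hM₃ e he f hf hef x hx y hy
    · intro e he x hx
      rcases Finset.mem_insert.1 he with rfl | he
      · rcases Sym2.mem_iff.1 hx with rfl | rfl <;> assumption
      · exact (List.mem_filter.1 (hMH e he x hx)).1

theorem SimpleGraph.IsWellIndumatched.not_hasInducedMatching [Finite V] {G : SimpleGraph V}
    [DecidableRel G.Adj] {k : ℕ} (h : G.IsWellIndumatched k) (H : List V) :
    ¬ HasInducedMatching (fun v w => decide (G.Adj v w)) (k + 1) H := by
  intro hH
  obtain ⟨M, hM, hcard, -⟩ := hH.exists_isInducedMatching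
  obtain ⟨M', hle, hM'⟩ := Finite.exists_le_maximal hM
  have h₁ := h M' hM'
  have h₂ := Finset.card_le_card hle
  omega

end matching

theorem bitsVal_listWeight (S : List VertexData) :
    bitsVal (listWeight S) = (S.map fun v => bitsVal v.2.2).sum := by
  induction S with
  | nil => rfl
  | cons v S ih =>
    rw [List.map_cons, List.sum_cons, ← ih, ← bitsVal_bitsAdd]
    rfl

/-- The starting value `[]` of the fold may survive; being independent, it does no harm. -/
theorem heaviest_mem (F : List (List VertexData)) : heaviest F = [] ∨ heaviest F ∈ F := by
  induction F with
  | nil => exact .inl rfl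
  | cons S F ih =>
    change (if bitsLE (listWeight (heaviest F)) (listWeight S) then S else heaviest F) = [] ∨
      (if bitsLE (listWeight (heaviest F)) (listWeight S) then S else heaviest F) ∈ S :: F
    split_ifs
    · exact .inr List.mem_cons_self
    · exact ih.imp_right (List.mem_cons_of_mem _)

theorem le_heaviest (F : List (List VertexData)) : ∀ S ∈ F,
    bitsVal (listWeight S) ≤ bitsVal (listWeight (heaviest F)) := by
  induction F with
  | nil => simp
  | cons T F ih =>
    intro S hS
    change _ ≤ bitsVal (listWeight
      (if bitsLE (listWeight (heaviest F)) (listWeight T) then T else heaviest F))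
    split_ifs with h
    · rw [bitsLE_iff] at h
      rcases List.mem_cons.1 hS with rfl | hS
      · exact le_rfl
      · exact (ih S hS).trans h
    · rw [bitsLE_iff, not_le] at h
      rcases List.mem_cons.1 hS with rfl | hS
      · exact h.le
      · exact ih S hS

/-! ### Decoding the input and optimality of the output -/

namespace VertexWeightedGraph

variable (I : VertexWeightedGraph)

open Classical in
/-- The row of the adjacency matrix of a vertex. -/
noncomputable def row (i : Fin I.n) : List Bool :=
  (List.finRange I.n).map fun j => decide (I.graph.Adj i j)

/-- The data of a vertex. -/
noncomputable def data (i : Fin I.n) : VertexData := (i, (I.row i, encodeNat (I.weight i)))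

open Classical in
theorem rowAdj_data (i j : Fin I.n) : rowAdj (I.data i) (I.data j) = decide (I.graph.Adj i j) := by
  have h : (j : ℕ) < (I.row i).length := by simp [row]
  change ((I.row i).drop j).headD false = _
  rw [List.drop_eq_getElem_cons h, List.headD_cons]
  simp [row]

/-- From right to left, the digits before a `comma` are filed as the weight and those before a `bra`
as the row, completing the vertex. Prepending digits restores their order. -/
theorem parse_encode :
    parse ((I.encode.map token).reverse) =
      (List.finRange I.n).map fun i => (I.row i, encodeNat (I.weight i)) := by
  have hbits : ∀ (l b w : List Bool) (L : List (List Bool × List Bool)),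
      ((l.map Γ'.bit).map token).foldr (fun x s => parseStep s x) (b, (w, L)) = (l ++ b, (w, L)) := by
    intro l b w L
    induction l with
    | nil => rfl
    | cons c l ih => rw [List.map_cons, List.map_cons, List.foldr_cons, ih]; rfl
  -- Abstracting the rows to `g` lets the induction run over the outer list of vertices alone, as
  -- each row still ranges over all of them.
  have key : ∀ (l : List (Fin I.n)) (g : Fin I.n → List Bool),
      ∃ s, ((l.flatMap fun i => [Γ'.bra] ++ (g i).map Γ'.bit ++ [Γ'.comma] ++
        (encodeNat (I.weight i)).map Γ'.bit ++ [Γ'.ket]).map token).foldr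
          (fun x s => parseStep s x) ([], ([], [])) =
            (s, ([], l.map fun i => (g i, encodeNat (I.weight i)))) := by
    intro l g
    induction l with
    | nil => exact ⟨[], rfl⟩
    | cons i l ih =>
      obtain ⟨s, hs⟩ := ih
      refine ⟨[], ?_⟩
      rw [List.flatMap_cons, List.map_append, List.foldr_append, hs]
      simp only [List.map_append, List.foldr_append]
      rw [show ([Γ'.ket].map token).foldr (fun x s => parseStep s x)
        (s, ([], l.map fun i => (g i, encodeNat (I.weight i)))) =
          ([], ([], l.map fun i => (g i, encodeNat (I.weight i)))) from rfl, hbits (encodeNat (I.weight i)),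
        show ([Γ'.comma].map token).foldr (fun x s => parseStep s x) (encodeNat (I.weight i) ++ [],
          ([], l.map fun i => (g i, encodeNat (I.weight i)))) = ([], (encodeNat (I.weight i) ++ [],
            l.map fun i => (g i, encodeNat (I.weight i)))) from rfl, hbits (g i), List.append_nil, List.append_nil]
      rfl
  obtain ⟨s, hs⟩ := key (List.finRange I.n) I.row
  rw [parse, List.foldl_reverse, encode]
  simp only [row, List.map_map, Function.comp_def] at hs ⊢
  rw [hs]

/-- `number` lists vertices in decreasing order; the final reversal of the output undoes this. -/
theorem number_parse_encode :
    number (parse ((I.encode.map token).reverse)) = ((List.finRange I.n).reverse).map I.data := by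
  rw [parse_encode, number_eq, List.map_reverse]
  congr 1
  refine List.ext_getElem (by simp) fun i h₁ h₂ => ?_
  simp [data]

open Classical in
theorem exists_isMaxWeightIndepSet {j : ℕ}
    (hI : ∀ H : List (Fin I.n),
      ¬ HasInducedMatching (fun v w => decide (I.graph.Adj v w)) j H) :
    ∃ S : Finset (Fin I.n), I.IsMaxWeightIndepSet S ∧
      (solve j (I.encode.map token).reverse).reverse = I.charVec S := by
  let adj : Fin I.n → Fin I.n → Bool := fun v w => decide (I.graph.Adj v w)
  let H : List (Fin I.n) := (List.finRange I.n).reverse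
  have hH : H.Nodup := List.nodup_reverse.2 (List.nodup_finRange _)
  have hmap : misList rowAdj j (H.map I.data) = (misList adj j H).map (List.map I.data) :=
    misList_map adj rowAdj I.data I.rowAdj_data j H
  have hweight : ∀ l : List (Fin I.n),
      bitsVal (listWeight (l.map I.data)) = (l.map I.weight).sum := by
    intro l
    rw [bitsVal_listWeight, List.map_map]
    congr 2
    funext v
    exact bitsVal_encodeNat _
  obtain ⟨l, hl, hindep, hnodup⟩ : ∃ l : List (Fin I.n),
      heaviest (misList rowAdj j (H.map I.data)) = l.map I.data ∧
        (l.Pairwise fun v w => adj v w = false) ∧ l.Nodup := by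
    rcases heaviest_mem (misList rowAdj j (H.map I.data)) with h | h
    · exact ⟨[], h, List.Pairwise.nil, List.nodup_nil⟩
    · rw [hmap] at h
      obtain ⟨l, hl, e⟩ := List.mem_map.1 h
      exact ⟨l, hmap ▸ e.symm, pairwise_of_mem_misList adj j hl,
        hH.sublist (sublist_of_mem_misList adj j hl)⟩
  refine ⟨l.toFinset, ⟨?_, fun T hT => ?_⟩, ?_⟩
  · intro v hv w hw _
    rw [List.coe_toFinset] at hv hw
    have h : ∀ ⦃x⦄, x ∈ l → ∀ ⦃y⦄, y ∈ l → x ≠ y → ¬ I.graph.Adj x y :=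
      haveI : Std.Symm fun x y => ¬ I.graph.Adj x y := ⟨fun _ _ h h' => h h'.symm⟩
      (hindep.imp (S := fun x y => ¬ I.graph.Adj x y) fun h => of_decide_eq_false h).forall
    exact h hv hw ‹_›
  -- Enlarging `T` to a maximal independent set `M` does not lower its weight, and `M` is among the
  -- listed sets.
  · obtain ⟨M, hTM, hM⟩ := Finite.exists_le_maximal
      (p := fun S : Finset (Fin I.n) => I.graph.IsIndepSet (S : Set (Fin I.n))) hT
    obtain ⟨l', hl', hl'M⟩ := exists_mem_misList adj
      (fun x y => by simp [adj, SimpleGraph.adj_comm]) j hH (hI H) (S := (M : Set (Fin I.n)))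
      ⟨fun x _ => by simp [H], fun x hx y hy => by
        by_cases hxy : x = y
        · simp [adj, hxy]
        · simpa [adj] using hM.prop hx hy hxy, fun w _ hw => by
        by_contra! h
        refine hw (hM.le_of_ge (y := insert w M) ?_ (Finset.subset_insert w M)
          (Finset.mem_insert_self w M))
        rw [Finset.coe_insert]
        refine Set.Pairwise.insert hM.prop fun x hx _ => ?_
        have h' : ¬ I.graph.Adj w x := by simpa [adj] using h x hx
        exact ⟨h', fun e => h' e.symm⟩⟩
    have hnodup' : l'.Nodup := hH.sublist (sublist_of_mem_misList adj j hl')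
    have hM' : M = l'.toFinset := by
      ext x
      rw [List.mem_toFinset, hl'M, Finset.mem_coe]
    have hle := le_heaviest (misList rowAdj j (H.map I.data)) (l'.map I.data)
      (by rw [hmap]; exact List.mem_map_of_mem hl')
    rw [hl, hweight, hweight] at hle
    calc ∑ v ∈ T, I.weight v ≤ ∑ v ∈ M, I.weight v := Finset.sum_le_sum_of_subset hTM
      _ = (l'.map I.weight).sum := by rw [hM', List.sum_toFinset _ hnodup']
      _ ≤ (l.map I.weight).sum := hle
      _ = ∑ v ∈ l.toFinset, I.weight v := (List.sum_toFinset _ hnodup).symm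
  · have hV : number (parse ((I.encode.map token).reverse)) = H.map I.data :=
      I.number_parse_encode
    simp only [solve, hV, hl, charVec]
    rw [← List.map_reverse, ← List.map_reverse, List.reverse_reverse, List.map_map]
    refine List.map_congr_left fun v _ => ?_
    rw [Bool.eq_iff_iff]
    simp [data, Fin.val_inj]

end VertexWeightedGraph

theorem mainTheorem10 (k : ℕ) (hk : 0 < k) :
    WeightedIndepSetSolvableInPolyTime (fun _ G => G.IsWellIndumatched k) := by
  classical
  exact ⟨fun I => (solve (k + 1) (I.1.encode.map token).reverse).reverse,
    fun I => I.1.exists_isMaxWeightIndepSet I.2.not_hasInducedMatching,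
    (PT.solve (k + 1)).nonempty_computableInPolyTime _⟩
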